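/- **Setting.** Let $\mathfrak g=\mathfrak g_0\oplus\mathfrak g_1$ be a finite-dimensional complex Lie superalgebra with a non-degenerate, invariant, even, supersymmetric bilinear form $b$, such that $\mathfrak g$ is a semi-simple $\mathfrak g_0$-module and the centre of $\mathfrak g$ is contained in $\mathfrak g_0$. Let $\theta$ be an involutive automorphism of $\mathfrak g$ preserving $b$, and $\mathfrak g=\mathfrak k\oplus\mathfrak p$ its decomposition into the $(+1)$- and $(-1)$-eigenspaces, $\mathfrak k_i=\mathfrak k\cap\mathfrak g_i$, $\mathfrak p_i=\mathfrak p\cap\mathfrak g_i$. Let $\mathfrak a\subset\mathfrak p_0$ be an even Cartan subspace, i.e. a subspace consisting of semi-simple elements of $\mathfrak g_0$ with $\mathfrak a=\{x\in\mathfrak p\mid[x,\mathfrak a]=0\}$. For $\lambda\in\mathfrak a^*$ let $\mathfrak g_{j}^\lambda=\{x\in\mathfrak g_j\mid[h,x]=\lambda(h)x\ \forall h\in\mathfrak a\}$, let $\Sigma_j=\{\lambda\neq0\mid\mathfrak g_j^\lambda\neq0\}$, $\Sigma=\Sigma_0\cup\Sigma_1$, and fix $\Sigma^+\subset\Sigma$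 such that $\Sigma$ is the disjoint union of $\Sigma^+$ and $-\Sigma^+$. Let $\bar\Sigma_1^+$ be the set of $\lambda\in\Sigma_1\cap\Sigma^+$ with $\lambda,2\lambda\notin\Sigma_0$. For $\lambda\in\bar\Sigma_1^+$ let $A_\lambda\in\mathfrak a$ be the vector with $b(A_\lambda,h)=\lambda(h)$ for all $h\in\mathfrak a$, and let $\mathfrak k_1^\lambda$, $\mathfrak p_1^\lambda$ be the intersections of $\mathfrak g_1^\lambda\oplus\mathfrak g_1^{-\lambda}$ with $\mathfrak k_1$ and $\mathfrak p_1$. Choose bases $y_i,\tilde y_i$ of $\mathfrak k_1^\lambda$ and $z_i,\tilde z_i$ of $\mathfrak p_1^\lambda$ ($1\le i\le n=\frac12\dim\mathfrak g_1^\lambda$) with $$b(y_i,\tilde y_j)=b(\tilde z_j,z_i)=\delta_{ij},\qquad b(y_i,y_j)=b(\tilde y_i,\tilde y_j)=b(z_i,z_j)=b(\tilde z_i,\tilde z_j)=0,$$ and $y_i+z_i,\ \tilde y_i+\tilde z_i\in\mathfrak g_1^\lambda$. For $I=(i_1<\dots<i_k)$ put $z_I\tilde z_I=z_{i_1}\cdots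 z_{i_k}\tilde z_{i_1}\cdots\tilde z_{i_k}\in S(\mathfrak p)=S(\mathfrak p_0)\otimes\bigwedge(\mathfrak p_1)$. For $z\in\mathfrak p_0$ let $\mathfrak k$ act on $S(\mathfrak p)$ by $u_z(x)d=[x,z]d+\mathrm{ad}(x)(d)$, where $\mathrm{ad}(x)$ is the superderivation extending the adjoint action, and extend $u_z$ to the enveloping algebra $U(\mathfrak k)$. Let $\beta$ be the supersymmetrisation map, and define $$\Gamma_z:\textstyle\bigwedge(\mathfrak p_1)\otimes S(\mathfrak p_0)\to S(\mathfrak p),\qquad \Gamma_z(q\otimes p)=u_z(\beta([z,q]))p,$$ where $q\mapsto[z,q]$ is the algebra homomorphism $\bigwedge(\mathfrak p_1)\to\bigwedge(\mathfrak k_1)$ extending $\mathrm{ad}\,z$. The element $z$ is oddly regular if $\mathrm{ad}\,z:\mathfrak k_1\to\mathfrak p_1$ is surjective. If $\Gamma_z$ is bijective, the radial part map is $\gamma_z=(\varepsilon\otimes1)\circ\Gamma_z^{-1}:S(\mathfrak p)\to S(\mathfrak p_0)$, with $\varepsilon$ the augmentation of $\bigwedge(\mathfrak p_1)$. **Lemma.**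 Let $\lambda\in\bar\Sigma_1^+$, let $h\in\mathfrak a$ be oddly regular, and let $I$ be a multi-index with $k=|I|\ge1$. Then $A_\lambda$ as above exists, $\lambda(h)\neq0$, $\Gamma_h$ is bijective, and $$\gamma_h(z_I\tilde z_I)=(-1)^{\frac{k(k+1)}2}\sum_{j=0}^{k-1}\frac{(k-1+j)!}{2^j(k-1-j)!\,j!}\,\frac{(-\lambda(A_\lambda))^j}{\lambda(h)^{k+j}}\,A_\lambda^{k-j}.$$ -/

import Mathlib

open scoped TensorProduct

noncomputable section

/-! ### The supersymmetric algebra of a super vector space `V ⊕ W` (`V` even, `W` odd) -/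

/-- `S(V ⊕ W) = S(V) ⊗ ⋀(W)` for a super vector space with even part `V` and odd part `W`. -/
def SuperSym (V W : Type*) [AddCommGroup V] [Module ℂ V] [AddCommGroup W] [Module ℂ W] :=
  SymmetricAlgebra ℂ V ⊗[ℂ] ExteriorAlgebra ℂ W

namespace SuperSym

variable {V W : Type*} [AddCommGroup V] [Module ℂ V] [AddCommGroup W] [Module ℂ W]

instance : Ring (SuperSym V W) :=
  inferInstanceAs (Ring (SymmetricAlgebra ℂ V ⊗[ℂ] ExteriorAlgebra ℂ W))

instance : Algebra ℂ (SuperSym V W) :=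
  inferInstanceAs (Algebra ℂ (SymmetricAlgebra ℂ V ⊗[ℂ] ExteriorAlgebra ℂ W))

variable (V W) in
/-- The tautological identification with the tensor product algebra. -/
def equiv : SuperSym V W ≃ₐ[ℂ] SymmetricAlgebra ℂ V ⊗[ℂ] ExteriorAlgebra ℂ W := AlgEquiv.refl

/-- The inclusion of `S(V)`. -/
def evenPart : SymmetricAlgebra ℂ V →ₐ[ℂ] SuperSym V W :=
  (equiv V W).symm.toAlgHom.comp Algebra.TensorProduct.includeLeft

/-- The inclusion of `⋀(W)`. -/
def oddPart : ExteriorAlgebra ℂ W →ₐ[ℂ] SuperSym V W :=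
  (equiv V W).symm.toAlgHom.comp Algebra.TensorProduct.includeRight

theorem equiv_symm_tmul (s : SymmetricAlgebra ℂ V) (t : ExteriorAlgebra ℂ W) :
    (equiv V W).symm (s ⊗ₜ t) = evenPart s * oddPart t := by
  apply (equiv V W).injective
  simp [evenPart, oddPart]

theorem evenPart_mul_comm (s : SymmetricAlgebra ℂ V) (a : SuperSym V W) :
    evenPart s * a = a * evenPart s := by
  apply (equiv V W).injective
  simp only [evenPart, map_mul, AlgHom.comp_apply, AlgEquiv.toAlgHom_apply,
    AlgEquiv.apply_symm_apply, Algebra.TensorProduct.includeLeft_apply]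
  induction (equiv V W a) using TensorProduct.induction_on with
  | zero => simp
  | tmul s t => simp [mul_comm]
  | add a b ha hb => simp [mul_add, add_mul, ha, hb]

/-- Even generators. -/
def even : V →ₗ[ℂ] SuperSym V W := evenPart.toLinearMap ∘ₗ SymmetricAlgebra.ι ℂ V

/-- Odd generators. -/
def odd : W →ₗ[ℂ] SuperSym V W := oddPart.toLinearMap ∘ₗ ExteriorAlgebra.ι ℂ

theorem induction {P : SuperSym V W → Prop} (h1 : P 1) (hadd : ∀ a b, P a → P b → P (a + b))
    (hsmul : ∀ (c : ℂ) a, P a → P (c • a)) (he : ∀ v a, P a → P (even v * a))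
    (ho : ∀ w a, P a → P (odd w * a)) (a : SuperSym V W) : P a := by
  have hE : ∀ (s : SymmetricAlgebra ℂ V) (a : SuperSym V W), P a → P (evenPart s * a) := by
    intro s
    induction s using SymmetricAlgebra.induction with
    | algebraMap r =>
      intro a ha
      rw [AlgHom.commutes, ← Algebra.smul_def]
      exact hsmul _ _ ha
    | ι x => intro a ha; exact he _ _ ha
    | mul s t hs ht => intro a ha; rw [map_mul, mul_assoc]; exact hs _ (ht _ ha)
    | add s t hs ht => intro a ha; rw [map_add, add_mul]; exact hadd _ _ (hs _ ha) (ht _ ha)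
  have hO : ∀ (s : ExteriorAlgebra ℂ W) (a : SuperSym V W), P a → P (oddPart s * a) := by
    intro s
    induction s using ExteriorAlgebra.induction with
    | algebraMap r =>
      intro a ha
      rw [AlgHom.commutes, ← Algebra.smul_def]
      exact hsmul _ _ ha
    | ι x => intro a ha; exact ho _ _ ha
    | mul s t hs ht => intro a ha; rw [map_mul, mul_assoc]; exact hs _ (ht _ ha)
    | add s t hs ht => intro a ha; rw [map_add, add_mul]; exact hadd _ _ (hs _ ha) (ht _ ha)
  obtain ⟨a, rfl⟩ := (equiv V W).symm.surjective a
  induction a using TensorProduct.induction_on with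
  | zero => simpa using hsmul 0 1 h1
  | tmul s t =>
    rw [equiv_symm_tmul, ← mul_one (oddPart t)]
    exact hE _ _ (hO _ _ h1)
  | add a b ha hb => rw [map_add]; exact hadd _ _ ha hb

theorem even_mul_comm (v : V) (a : SuperSym V W) : even v * a = a * even v :=
  evenPart_mul_comm _ _

theorem odd_mul_odd (v w : W) : (odd v * odd w : SuperSym V W) = -(odd w * odd v) := by
  have h : ExteriorAlgebra.ι ℂ v * ExteriorAlgebra.ι ℂ w
      = -(ExteriorAlgebra.ι ℂ w * ExteriorAlgebra.ι ℂ v) :=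
    eq_neg_of_add_eq_zero_left (ExteriorAlgebra.ι_add_mul_swap v w)
  simp only [odd, LinearMap.comp_apply, AlgHom.toLinearMap_apply, ← map_mul, h, map_neg]

theorem odd_mul_self (v : W) : (odd v * odd v : SuperSym V W) = 0 := by
  simp only [odd, LinearMap.comp_apply, AlgHom.toLinearMap_apply, ← map_mul,
    ExteriorAlgebra.ι_sq_zero, map_zero]

/-- A linear endomorphism that kills `1` and (super-)commutes with all generators vanishes. -/
theorem eq_zero_of_gen (T : SuperSym V W →ₗ[ℂ] SuperSym V W) (s : ℂ) (h1 : T 1 = 0)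
    (he : ∀ v a, T (even v * a) = even v * T a)
    (ho : ∀ w a, T (odd w * a) = s • (odd w * T a)) : T = 0 := by
  refine LinearMap.ext fun a => ?_
  induction a using induction with
  | h1 => simpa using h1
  | hadd a b ha hb => rw [map_add, ha, hb]; simp
  | hsmul c a ha => rw [map_smul, ha]; simp
  | he v a ha => rw [he, ha]; simp
  | ho w a ha => rw [ho, ha]; simp

section

open scoped IsMulCommutative

/-- Extension of a linear map with commuting values to the symmetric algebra. -/
def symLift {C : Type*} [Ring C] [Algebra ℂ C] (f : V →ₗ[ℂ] C)
    (hf : ∀ x y, f x * f y = f y * f x) : SymmetricAlgebra ℂ V →ₐ[ℂ] C :=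
  haveI : IsMulCommutative (Algebra.adjoin ℂ (Set.range f)) :=
    Algebra.isMulCommutative_adjoin ℂ (by
      rintro _ ⟨x, rfl⟩ _ ⟨y, rfl⟩
      exact hf x y)
  (Algebra.adjoin ℂ (Set.range f)).val.comp
    (SymmetricAlgebra.lift
      (f.codRestrict (Subalgebra.toSubmodule (Algebra.adjoin ℂ (Set.range f)))
        fun x => Algebra.subset_adjoin ⟨x, rfl⟩))

theorem symLift_ι {C : Type*} [Ring C] [Algebra ℂ C] (f : V →ₗ[ℂ] C)
    (hf : ∀ x y, f x * f y = f y * f x) (x : V) : symLift f hf (SymmetricAlgebra.ι ℂ V x) = f x := by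
  simp only [symLift, AlgHom.comp_apply, SymmetricAlgebra.lift_ι_apply]
  rfl

end

section deriv

variable (s : ℂ) (f₀ : V →ₗ[ℂ] SuperSym V W) (f₁ : W →ₗ[ℂ] SuperSym V W)

/-- `v ↦ (v, f₀ v; 0, v)`. -/
def mat₀ : V →ₗ[ℂ] Matrix (Fin 2) (Fin 2) (SuperSym V W) where
  toFun v := !![even v, f₀ v; 0, even v]
  map_add' x y := by ext i j; fin_cases i <;> fin_cases j <;> simp
  map_smul' c x := by ext i j; fin_cases i <;> fin_cases j <;> simp

/-- `w ↦ (s w, f₁ w; 0, w)`. -/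
def mat₁ : W →ₗ[ℂ] Matrix (Fin 2) (Fin 2) (SuperSym V W) where
  toFun w := !![s • odd w, f₁ w; 0, odd w]
  map_add' x y := by ext i j; fin_cases i <;> fin_cases j <;> simp
  map_smul' c x := by
    ext i j; fin_cases i <;> fin_cases j <;> simp [smul_comm c s]

theorem mat₀_comm (x y : V) : mat₀ f₀ x * mat₀ f₀ y = mat₀ f₀ y * mat₀ f₀ x := by
  ext i j
  fin_cases i <;> fin_cases j <;>
    simp [mat₀, Matrix.mul_apply, Fin.sum_univ_two, even_mul_comm x (even y),
      even_mul_comm x (f₀ y), even_mul_comm y (f₀ x), add_comm]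

theorem mat₁_sq (h₁ : ∀ w, s • (odd w * f₁ w) + f₁ w * odd w = 0) (w : W) :
    mat₁ s f₁ w * mat₁ s f₁ w = 0 := by
  ext i j
  fin_cases i <;> fin_cases j <;>
    simp [mat₁, Matrix.mul_apply, Fin.sum_univ_two, odd_mul_self, h₁]

theorem mat₀_mat₁_comm (h₀ : ∀ v w, f₀ v * odd w = s • (odd w * f₀ v)) (v : V) (w : W) :
    Commute (mat₀ f₀ v) (mat₁ s f₁ w) := by
  ext i j
  fin_cases i <;> fin_cases j <;>
    simp [mat₀, mat₁, Matrix.mul_apply, Fin.sum_univ_two, even_mul_comm v, h₀, add_comm]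

variable (h₀ : ∀ v w, f₀ v * odd w = s • (odd w * f₀ v))
  (h₁ : ∀ w, s • (odd w * f₁ w) + f₁ w * odd w = 0)

/-- The algebra homomorphism `a ↦ (σ(a), D(a); 0, a)`, where `σ` multiplies the odd generators
by `s` and `D` is the (super-)derivation given by `f₀` and `f₁` on generators. -/
def derivHom : SuperSym V W →ₐ[ℂ] Matrix (Fin 2) (Fin 2) (SuperSym V W) :=
  AlgHom.comp (Algebra.TensorProduct.lift (symLift (mat₀ f₀) (mat₀_comm f₀))
    (ExteriorAlgebra.lift ℂ ⟨mat₁ s f₁, mat₁_sq s f₁ h₁⟩) (by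
      intro a b
      induction a using SymmetricAlgebra.induction with
      | algebraMap r => rw [AlgHom.commutes]; exact Algebra.commutes _ _
      | mul x y hx hy => rw [map_mul]; exact hx.mul_left hy
      | add x y hx hy => rw [map_add]; exact hx.add_left hy
      | ι v =>
        rw [symLift_ι]
        induction b using ExteriorAlgebra.induction with
        | algebraMap r => rw [AlgHom.commutes]; exact (Algebra.commutes _ _).symm
        | mul x y hx hy => rw [map_mul]; exact hx.mul_right hy
        | add x y hx hy => rw [map_add]; exact hx.add_right hy
        | ι w => rw [ExteriorAlgebra.lift_ι_apply]; exact mat₀_mat₁_comm s f₀ f₁ h₀ v w))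
    (equiv V W).toAlgHom

theorem derivHom_even (v : V) : derivHom s f₀ f₁ h₀ h₁ (even v) = mat₀ f₀ v := by
  simp [derivHom, even, evenPart, symLift_ι]

theorem derivHom_odd (w : W) : derivHom s f₀ f₁ h₀ h₁ (odd w) = mat₁ s f₁ w := by
  simp [derivHom, odd, oddPart]

theorem derivHom_lower (a : SuperSym V W) :
    derivHom s f₀ f₁ h₀ h₁ a 1 0 = 0 ∧ derivHom s f₀ f₁ h₀ h₁ a 1 1 = a := by
  induction a using induction with
  | h1 => simp
  | hadd a b ha hb => simp [ha, hb]
  | hsmul c a ha => simp [ha]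
  | he v a ha =>
    simp [derivHom_even, Matrix.mul_apply, Fin.sum_univ_two, ha, mat₀]
  | ho w a ha =>
    simp [derivHom_odd, Matrix.mul_apply, Fin.sum_univ_two, ha, mat₁]

/-- The unique linear endomorphism `D` of `S(V ⊕ W)` with `D(1) = 0`,
`D(v a) = f₀(v) a + v D(a)` for `v ∈ V` and `D(w a) = f₁(w) a + s w D(a)` for `w ∈ W`;
for `s = 1` a derivation, for `s = -1` an odd superderivation. -/
def deriv : SuperSym V W →ₗ[ℂ] SuperSym V W :=
  Matrix.entryLinearMap ℂ _ 0 1 ∘ₗ (derivHom s f₀ f₁ h₀ h₁).toLinearMap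

theorem deriv_one : deriv s f₀ f₁ h₀ h₁ 1 = 0 := by
  simp [deriv]

theorem deriv_even_mul (v : V) (a : SuperSym V W) :
    deriv s f₀ f₁ h₀ h₁ (even v * a) = f₀ v * a + even v * deriv s f₀ f₁ h₀ h₁ a := by
  simp only [deriv, LinearMap.comp_apply, AlgHom.toLinearMap_apply, map_mul, derivHom_even,
    Matrix.entryLinearMap_apply, Matrix.mul_apply, Fin.sum_univ_two,
    (derivHom_lower s f₀ f₁ h₀ h₁ a).2]
  simp [mat₀, add_comm]

theorem deriv_odd_mul (w : W) (a : SuperSym V W) :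
    deriv s f₀ f₁ h₀ h₁ (odd w * a) = f₁ w * a + s • (odd w * deriv s f₀ f₁ h₀ h₁ a) := by
  simp only [deriv, LinearMap.comp_apply, AlgHom.toLinearMap_apply, map_mul, derivHom_odd,
    Matrix.entryLinearMap_apply, Matrix.mul_apply, Fin.sum_univ_two,
    (derivHom_lower s f₀ f₁ h₀ h₁ a).2]
  simp [mat₁, add_comm]

end deriv

end SuperSym

/-! ### Complex Lie superalgebras and symmetric superpairs -/

/-- A complex Lie superalgebra `𝔤 = 𝔤₀ ⊕ 𝔤₁`: a Lie algebra `𝔤₀`, a `𝔤₀`-module `𝔤₁` (whose action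
`⁅x, u⁆` is the bracket of even with odd elements, `[u, x] = -⁅x, u⁆`), and the bracket of odd
elements `𝔤₁ × 𝔤₁ → 𝔤₀`, subject to super-antisymmetry and to the super Jacobi identity. -/
class LieSuperalgebra (𝔤₀ 𝔤₁ : Type*) [LieRing 𝔤₀] [LieAlgebra ℂ 𝔤₀] [AddCommGroup 𝔤₁]
    [Module ℂ 𝔤₁] [LieRingModule 𝔤₀ 𝔤₁] [LieModule ℂ 𝔤₀ 𝔤₁] where
  oddBracket : 𝔤₁ →ₗ[ℂ] 𝔤₁ →ₗ[ℂ] 𝔤₀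
  oddBracket_symm : ∀ u v, oddBracket u v = oddBracket v u
  lie_oddBracket : ∀ (x : 𝔤₀) (u v : 𝔤₁),
    ⁅x, oddBracket u v⁆ = oddBracket ⁅x, u⁆ v + oddBracket u ⁅x, v⁆
  oddBracket_cyclic : ∀ u v w : 𝔤₁,
    ⁅oddBracket u v, w⁆ + ⁅oddBracket v w, u⁆ + ⁅oddBracket w u, v⁆ = 0

open LieSuperalgebra

/-- A symmetric superpair: a complex quadratic Lie superalgebra `(𝔤, b)` with an involutive
automorphism `θ` preserving `b`. Since `b` and `θ` are even, they are given by their restrictions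
`b₀`, `θ₀` to `𝔤₀` and `b₁`, `θ₁` to `𝔤₁`. -/
structure SymmetricSuperpair (𝔤₀ 𝔤₁ : Type*) [LieRing 𝔤₀] [LieAlgebra ℂ 𝔤₀] [AddCommGroup 𝔤₁]
    [Module ℂ 𝔤₁] [LieRingModule 𝔤₀ 𝔤₁] [LieModule ℂ 𝔤₀ 𝔤₁] [LieSuperalgebra 𝔤₀ 𝔤₁] where
  b₀ : 𝔤₀ →ₗ[ℂ] 𝔤₀ →ₗ[ℂ] ℂ
  b₁ : 𝔤₁ →ₗ[ℂ] 𝔤₁ →ₗ[ℂ] ℂ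
  b₀_symm : ∀ x y, b₀ x y = b₀ y x
  b₁_antisymm : ∀ u v, b₁ u v = -b₁ v u
  b₀_nondegenerate : ∀ x, (∀ y, b₀ x y = 0) → x = 0
  b₁_nondegenerate : ∀ u, (∀ v, b₁ u v = 0) → u = 0
  /-- Invariance `b([x, y], z) = b(x, [y, z])` for the four parity patterns for which the two
  sides do not vanish trivially. -/
  b_invariant₀₀₀ : ∀ x y z : 𝔤₀, b₀ ⁅x, y⁆ z = b₀ x ⁅y, z⁆
  b_invariant₀₁₁ : ∀ (x : 𝔤₀) (u v : 𝔤₁), b₁ ⁅x, u⁆ v = b₀ x (oddBracket u v)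
  b_invariant₁₀₁ : ∀ (u : 𝔤₁) (x : 𝔤₀) (v : 𝔤₁), b₁ (-⁅x, u⁆) v = b₁ u ⁅x, v⁆
  b_invariant₁₁₀ : ∀ (u v : 𝔤₁) (x : 𝔤₀), b₀ (oddBracket u v) x = b₁ u (-⁅x, v⁆)
  θ₀ : 𝔤₀ →ₗ[ℂ] 𝔤₀
  θ₁ : 𝔤₁ →ₗ[ℂ] 𝔤₁
  θ₀_θ₀ : ∀ x, θ₀ (θ₀ x) = x
  θ₁_θ₁ : ∀ u, θ₁ (θ₁ u) = u
  θ₀_lie : ∀ x y : 𝔤₀, θ₀ ⁅x, y⁆ = ⁅θ₀ x, θ₀ y⁆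
  θ₁_lie : ∀ (x : 𝔤₀) (u : 𝔤₁), θ₁ ⁅x, u⁆ = ⁅θ₀ x, θ₁ u⁆
  θ₀_oddBracket : ∀ u v : 𝔤₁, θ₀ (oddBracket u v) = oddBracket (θ₁ u) (θ₁ v)
  b₀_θ₀ : ∀ x y, b₀ (θ₀ x) (θ₀ y) = b₀ x y
  b₁_θ₁ : ∀ u v, b₁ (θ₁ u) (θ₁ v) = b₁ u v

namespace SymmetricSuperpair

variable {𝔤₀ 𝔤₁ : Type*} [LieRing 𝔤₀] [LieAlgebra ℂ 𝔤₀] [AddCommGroup 𝔤₁]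
    [Module ℂ 𝔤₁] [LieRingModule 𝔤₀ 𝔤₁] [LieModule ℂ 𝔤₀ 𝔤₁] [LieSuperalgebra 𝔤₀ 𝔤₁]
    (S : SymmetricSuperpair 𝔤₀ 𝔤₁)

variable (𝔤₀ 𝔤₁) in
/-- A Lie superalgebra is basic if `𝔤 = 𝔤₀ ⊕ 𝔤₁` is a semi-simple `𝔤₀`-module (equivalently, both
summands are) and its centre (a graded subspace) is contained in `𝔤₀`. -/
structure _root_.LieSuperalgebra.IsBasic : Prop where
  semisimple₀ : ComplementedLattice (LieSubmodule ℂ 𝔤₀ 𝔤₀)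
  semisimple₁ : ComplementedLattice (LieSubmodule ℂ 𝔤₀ 𝔤₁)
  center_even : ∀ u : 𝔤₁, (∀ x : 𝔤₀, ⁅x, u⁆ = 0) → (∀ v : 𝔤₁, oddBracket (𝔤₀ := 𝔤₀) u v = 0) → u = 0

/-- A symmetric superpair is reductive if the Lie superalgebra `𝔤` is basic. -/
def IsReductive (_S : SymmetricSuperpair 𝔤₀ 𝔤₁) : Prop := LieSuperalgebra.IsBasic 𝔤₀ 𝔤₁

/-- `𝔨₀`, the `θ`-fixed even elements. -/
def k₀ : LieSubalgebra ℂ 𝔤₀ where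
  carrier := {x | S.θ₀ x = x}
  add_mem' hx hy := by simp_all
  zero_mem' := by simp
  smul_mem' c x hx := by simp_all
  lie_mem' hx hy := by simp_all [S.θ₀_lie]

/-- `𝔨₁`, the `θ`-fixed odd elements. -/
def k₁ : Submodule ℂ 𝔤₁ where
  carrier := {u | S.θ₁ u = u}
  add_mem' hx hy := by simp_all
  zero_mem' := by simp
  smul_mem' c x hx := by simp_all

/-- `𝔭₀`, the even part of the `-1`-eigenspace of `θ`. -/
def p₀ : Submodule ℂ 𝔤₀ where
  carrier := {x | S.θ₀ x = -x}
  add_mem' hx hy := by simp_all [add_comm]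
  zero_mem' := by simp
  smul_mem' c x hx := by simp_all

/-- `𝔭₁`, the odd part of the `-1`-eigenspace of `θ`. -/
def p₁ : Submodule ℂ 𝔤₁ where
  carrier := {u | S.θ₁ u = -u}
  add_mem' hx hy := by simp_all [add_comm]
  zero_mem' := by simp
  smul_mem' c x hx := by simp_all

theorem θ₀_k (x : S.k₀) : S.θ₀ x = x := x.2
theorem θ₁_k (u : S.k₁) : S.θ₁ u = u := u.2
theorem θ₀_p (x : S.p₀) : S.θ₀ x = -x := x.2
theorem θ₁_p (u : S.p₁) : S.θ₁ u = -u := u.2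

/-! The components of the bracket with respect to `𝔤 = 𝔨₀ ⊕ 𝔭₀ ⊕ 𝔨₁ ⊕ 𝔭₁` -/

/-- `[x, ·] : 𝔭₀ → 𝔭₀` for `x ∈ 𝔨₀`. -/
def adk₀p₀ (x : S.k₀) : S.p₀ →ₗ[ℂ] S.p₀ where
  toFun z := ⟨⁅(x : 𝔤₀), (z : 𝔤₀)⁆, by
    change S.θ₀ _ = _; rw [S.θ₀_lie, S.θ₀_k, S.θ₀_p, lie_neg]⟩
  map_add' y z := by ext; simp
  map_smul' c z := by ext; simp

/-- `[x, ·] : 𝔭₁ → 𝔭₁` for `x ∈ 𝔨₀`. -/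
def adk₀p₁ (x : S.k₀) : S.p₁ →ₗ[ℂ] S.p₁ where
  toFun u := ⟨⁅(x : 𝔤₀), (u : 𝔤₁)⁆, by
    change S.θ₁ _ = _; rw [S.θ₁_lie, S.θ₀_k, S.θ₁_p, lie_neg]⟩
  map_add' y z := by ext; simp
  map_smul' c z := by ext; simp

/-- `[u, ·] : 𝔭₀ → 𝔭₁` for `u ∈ 𝔨₁`. -/
def adk₁p₀ (u : S.k₁) : S.p₀ →ₗ[ℂ] S.p₁ where
  toFun z := ⟨-⁅(z : 𝔤₀), (u : 𝔤₁)⁆, by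
    change S.θ₁ _ = _; rw [map_neg, S.θ₁_lie, S.θ₁_k, S.θ₀_p, neg_lie]⟩
  map_add' y z := by
    apply Subtype.ext
    change -⁅(y : 𝔤₀) + (z : 𝔤₀), (u : 𝔤₁)⁆ = -⁅(y : 𝔤₀), (u : 𝔤₁)⁆ + -⁅(z : 𝔤₀), (u : 𝔤₁)⁆
    rw [add_lie, neg_add]
  map_smul' c z := by
    apply Subtype.ext
    change -⁅c • (z : 𝔤₀), (u : 𝔤₁)⁆ = c • -⁅(z : 𝔤₀), (u : 𝔤₁)⁆
    rw [smul_lie, smul_neg]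

/-- `[u, ·] : 𝔭₁ → 𝔭₀` for `u ∈ 𝔨₁`. -/
def adk₁p₁ (u : S.k₁) : S.p₁ →ₗ[ℂ] S.p₀ where
  toFun v := ⟨oddBracket (u : 𝔤₁) (v : 𝔤₁), by
    change S.θ₀ _ = _; rw [S.θ₀_oddBracket, S.θ₁_k, S.θ₁_p, map_neg]⟩
  map_add' y z := by ext; simp
  map_smul' c z := by ext; simp

/-- `[x, u] ∈ 𝔨₁` for `x ∈ 𝔨₀`, `u ∈ 𝔨₁`. -/
def lie₀₁ (x : S.k₀) (u : S.k₁) : S.k₁ :=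
  ⟨⁅(x : 𝔤₀), (u : 𝔤₁)⁆, by change S.θ₁ _ = _; rw [S.θ₁_lie, S.θ₀_k, S.θ₁_k]⟩

/-- `[u, v] ∈ 𝔨₀` for `u, v ∈ 𝔨₁`. -/
def lie₁₁ (u v : S.k₁) : S.k₀ :=
  ⟨oddBracket (u : 𝔤₁) (v : 𝔤₁), by change S.θ₀ _ = _; rw [S.θ₀_oddBracket, S.θ₁_k, S.θ₁_k]⟩

/-- `ad z : 𝔭₁ → 𝔨₁` for `z ∈ 𝔭₀`. -/
def adp₀p₁ (z : S.p₀) : S.p₁ →ₗ[ℂ] S.k₁ where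
  toFun u := ⟨⁅(z : 𝔤₀), (u : 𝔤₁)⁆, by
    change S.θ₁ _ = _; rw [S.θ₁_lie, S.θ₀_p, S.θ₁_p, lie_neg, neg_lie, neg_neg]⟩
  map_add' y z := by ext; simp
  map_smul' c z := by ext; simp

/-- `ad z : 𝔨₁ → 𝔭₁` for `z ∈ 𝔭₀`. -/
def adp₀k₁ (z : S.p₀) : S.k₁ →ₗ[ℂ] S.p₁ where
  toFun u := ⟨⁅(z : 𝔤₀), (u : 𝔤₁)⁆, by
    change S.θ₁ _ = _; rw [S.θ₁_lie, S.θ₀_p, S.θ₁_k, neg_lie]⟩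
  map_add' y z := by ext; simp
  map_smul' c z := by ext; simp

/-- `z ∈ 𝔭₀` is oddly regular if `ad z : 𝔨₁ → 𝔭₁` is surjective. -/
def IsOddlyRegular (z : S.p₀) : Prop := Function.Surjective (S.adp₀k₁ z)

/-! ### The adjoint and the twisted action of `𝔨` on `S(𝔭)` -/

/-- The supersymmetric algebra `S(𝔭) = S(𝔭₀) ⊗ ⋀(𝔭₁)`. -/
abbrev Sp := SuperSym S.p₀ S.p₁

open SuperSym

/-- `ad x` for `x ∈ 𝔨₀`: the even derivation of `S(𝔭)` extending `[x, ·]` on `𝔭`. -/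
def ad₀ (x : S.k₀) : S.Sp →ₗ[ℂ] S.Sp :=
  SuperSym.deriv 1 (even ∘ₗ S.adk₀p₀ x) (odd ∘ₗ S.adk₀p₁ x)
    (fun v w => by simp [even_mul_comm])
    (fun w => by simp [odd_mul_odd w])

/-- `ad u` for `u ∈ 𝔨₁`: the odd superderivation of `S(𝔭)` extending `[u, ·]` on `𝔭`. -/
def ad₁ (u : S.k₁) : S.Sp →ₗ[ℂ] S.Sp :=
  SuperSym.deriv (-1) (odd ∘ₗ S.adk₁p₀ u) (even ∘ₗ S.adk₁p₁ u)
    (fun v w => by simp [odd_mul_odd w])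
    (fun w => by simp [even_mul_comm])

/-- `u_z(x) d = [x, z] d + ad(x)(d)` for `x ∈ 𝔨₀`. -/
def tw₀ (z : S.p₀) (x : S.k₀) : Module.End ℂ S.Sp :=
  LinearMap.mulLeft ℂ (even (S.adk₀p₀ x z)) + S.ad₀ x

/-- `u_z(u) d = [u, z] d + ad(u)(d)` for `u ∈ 𝔨₁`. -/
def tw₁ (z : S.p₀) (u : S.k₁) : Module.End ℂ S.Sp :=
  LinearMap.mulLeft ℂ (odd (S.adk₁p₀ u z)) + S.ad₁ u

section tw

variable (z : S.p₀) (x y : S.k₀) (u v : S.k₁) (q : S.p₀) (r : S.p₁) (d : S.Sp)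

theorem tw₀_one : S.tw₀ z x 1 = even (S.adk₀p₀ x z) := by
  simp [tw₀, ad₀, SuperSym.deriv_one]

theorem tw₁_one : S.tw₁ z u 1 = odd (S.adk₁p₀ u z) := by
  simp [tw₁, ad₁, SuperSym.deriv_one]

theorem tw₀_even : S.tw₀ z x (even q * d) = even (S.adk₀p₀ x q) * d + even q * S.tw₀ z x d := by
  simp only [tw₀, ad₀, LinearMap.add_apply, LinearMap.mulLeft_apply, deriv_even_mul,
    LinearMap.comp_apply, mul_add, ← mul_assoc, even_mul_comm q (even _)]
  abel

theorem tw₀_odd : S.tw₀ z x (odd r * d) = odd (S.adk₀p₁ x r) * d + odd r * S.tw₀ z x d := by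
  simp only [tw₀, ad₀, LinearMap.add_apply, LinearMap.mulLeft_apply, deriv_odd_mul,
    LinearMap.comp_apply, mul_add, ← mul_assoc, even_mul_comm _ (odd r), one_smul]
  abel

theorem tw₁_even : S.tw₁ z u (even q * d) = odd (S.adk₁p₀ u q) * d + even q * S.tw₁ z u d := by
  simp only [tw₁, ad₁, LinearMap.add_apply, LinearMap.mulLeft_apply, deriv_even_mul,
    LinearMap.comp_apply, mul_add, ← mul_assoc, even_mul_comm q (odd _)]
  abel

theorem tw₁_odd : S.tw₁ z u (odd r * d) = even (S.adk₁p₁ u r) * d - odd r * S.tw₁ z u d := by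
  simp only [tw₁, ad₁, LinearMap.add_apply, LinearMap.mulLeft_apply, deriv_odd_mul,
    LinearMap.comp_apply, mul_add, ← mul_assoc, odd_mul_odd _ r, neg_smul, one_smul, neg_mul]
  abel

theorem tw₀_add : S.tw₀ z (x + y) = S.tw₀ z x + S.tw₀ z y := by
  have h : ∀ q, S.adk₀p₀ (x + y) q = S.adk₀p₀ x q + S.adk₀p₀ y q := fun q => by
    ext; simp [adk₀p₀]
  have h' : ∀ q, S.adk₀p₁ (x + y) q = S.adk₀p₁ x q + S.adk₀p₁ y q := fun q => by
    ext; simp [adk₀p₁]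
  refine sub_eq_zero.1 (eq_zero_of_gen _ 1 ?_ ?_ ?_)
  · simp [tw₀_one, h]
  · intro q d; simp only [LinearMap.sub_apply, LinearMap.add_apply, tw₀_even, h, map_add]; noncomm_ring
  · intro q d
    simp only [LinearMap.sub_apply, LinearMap.add_apply, tw₀_odd, h', map_add, one_smul]; noncomm_ring

theorem tw₀_smul (c : ℂ) : S.tw₀ z (c • x) = c • S.tw₀ z x := by
  have h : ∀ q, S.adk₀p₀ (c • x) q = c • S.adk₀p₀ x q := fun q => by
    ext; simp [adk₀p₀]
  have h' : ∀ q, S.adk₀p₁ (c • x) q = c • S.adk₀p₁ x q := fun q => by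
    ext; simp [adk₀p₁]
  refine sub_eq_zero.1 (eq_zero_of_gen _ 1 ?_ ?_ ?_)
  · simp [tw₀_one, h]
  · intro q d
    simp [tw₀_even, h, mul_sub]
  · intro q d
    simp [tw₀_odd, h', mul_sub]

theorem tw₁_add : S.tw₁ z (u + v) = S.tw₁ z u + S.tw₁ z v := by
  have h : ∀ q, S.adk₁p₀ (u + v) q = S.adk₁p₀ u q + S.adk₁p₀ v q := fun q => by
    ext; simp [adk₁p₀, add_comm]
  have h' : ∀ q, S.adk₁p₁ (u + v) q = S.adk₁p₁ u q + S.adk₁p₁ v q := fun q => by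
    ext; simp [adk₁p₁]
  refine sub_eq_zero.1 (eq_zero_of_gen _ (-1) ?_ ?_ ?_)
  · simp [tw₁_one, h]
  · intro q d; simp only [LinearMap.sub_apply, LinearMap.add_apply, tw₁_even, h, map_add]; noncomm_ring
  · intro q d
    simp only [LinearMap.sub_apply, LinearMap.add_apply, tw₁_odd, h', map_add, neg_smul, one_smul]
    noncomm_ring

theorem tw₁_smul (c : ℂ) : S.tw₁ z (c • u) = c • S.tw₁ z u := by
  have h : ∀ q, S.adk₁p₀ (c • u) q = c • S.adk₁p₀ u q := fun q => by
    ext; simp [adk₁p₀]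
  have h' : ∀ q, S.adk₁p₁ (c • u) q = c • S.adk₁p₁ u q := fun q => by
    ext; simp [adk₁p₁]
  refine sub_eq_zero.1 (eq_zero_of_gen _ (-1) ?_ ?_ ?_)
  · simp [tw₁_one, h]
  · intro q d
    simp [tw₁_even, h, mul_sub]
  · intro q d
    simp only [LinearMap.sub_apply, LinearMap.smul_apply, tw₁_odd, h', map_smul, neg_smul, one_smul,
      smul_sub, smul_mul_assoc, mul_sub, mul_smul_comm]
    abel

/-- `u_z` as a linear map on `𝔨 = 𝔨₀ ⊕ 𝔨₁`. -/
def tw : S.k₀ × S.k₁ →ₗ[ℂ] Module.End ℂ S.Sp :=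
  LinearMap.coprod
    { toFun := S.tw₀ z, map_add' := S.tw₀_add z, map_smul' := fun c x => S.tw₀_smul z x c }
    { toFun := S.tw₁ z, map_add' := S.tw₁_add z, map_smul' := fun c x => S.tw₁_smul z x c }

theorem tw_even : S.tw z (x, 0) = S.tw₀ z x := by
  simp only [tw, LinearMap.coprod_apply, map_zero, add_zero]
  rfl

theorem tw_odd : S.tw z (0, u) = S.tw₁ z u := by
  simp only [tw, LinearMap.coprod_apply, map_zero, zero_add]
  rfl

theorem tw₀₀ : S.tw₀ z x * S.tw₀ z y = S.tw₀ z y * S.tw₀ z x + S.tw₀ z ⁅x, y⁆ := by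
  have h : ∀ q, S.adk₀p₀ ⁅x, y⁆ q = S.adk₀p₀ x (S.adk₀p₀ y q) - S.adk₀p₀ y (S.adk₀p₀ x q) :=
    fun q => by ext; simp [adk₀p₀]
  have h' : ∀ q, S.adk₀p₁ ⁅x, y⁆ q = S.adk₀p₁ x (S.adk₀p₁ y q) - S.adk₀p₁ y (S.adk₀p₁ x q) :=
    fun q => by ext; simp [adk₀p₁]
  refine sub_eq_zero.1 (eq_zero_of_gen _ 1 ?_ ?_ ?_)
  · have e := S.tw₀_even z x (S.adk₀p₀ y z) 1
    have e' := S.tw₀_even z y (S.adk₀p₀ x z) 1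
    simp only [mul_one, tw₀_one] at e e'
    simp only [LinearMap.sub_apply, LinearMap.add_apply, Module.End.mul_apply, tw₀_one, h, map_sub,
      e, e', even_mul_comm (S.adk₀p₀ y z)]
    abel
  · intro q d
    simp only [LinearMap.sub_apply, LinearMap.add_apply, Module.End.mul_apply, tw₀_even, h, map_sub,
      map_add]
    noncomm_ring
  · intro q d
    simp only [LinearMap.sub_apply, LinearMap.add_apply, Module.End.mul_apply, tw₀_odd, h', map_sub,
      map_add, one_smul]
    noncomm_ring

theorem tw₀₁ : S.tw₀ z x * S.tw₁ z u = S.tw₁ z u * S.tw₀ z x + S.tw₁ z (S.lie₀₁ x u) := by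
  have h : ∀ q, S.adk₁p₀ (S.lie₀₁ x u) q = S.adk₀p₁ x (S.adk₁p₀ u q) - S.adk₁p₀ u (S.adk₀p₀ x q) :=
    fun q => by ext; simp [adk₀p₀, adk₁p₀, adk₀p₁, lie₀₁]; abel
  have h' : ∀ q, S.adk₁p₁ (S.lie₀₁ x u) q = S.adk₀p₀ x (S.adk₁p₁ u q) - S.adk₁p₁ u (S.adk₀p₁ x q) :=
    fun q => by ext; simp [adk₀p₀, adk₁p₁, adk₀p₁, lie₀₁, lie_oddBracket]
  refine sub_eq_zero.1 (eq_zero_of_gen _ (-1) ?_ ?_ ?_)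
  · have e := S.tw₀_odd z x (S.adk₁p₀ u z) 1
    have e' := S.tw₁_even z u (S.adk₀p₀ x z) 1
    simp only [mul_one, tw₀_one, tw₁_one] at e e'
    simp only [LinearMap.sub_apply, LinearMap.add_apply, Module.End.mul_apply, tw₀_one, tw₁_one, h,
      map_sub, e, e', even_mul_comm (S.adk₀p₀ x z)]
    abel
  · intro q d
    simp only [LinearMap.sub_apply, LinearMap.add_apply, Module.End.mul_apply, tw₀_even, tw₁_even,
      tw₀_odd, h, map_sub, map_add]
    noncomm_ring
  · intro q d
    simp only [LinearMap.sub_apply, LinearMap.add_apply, Module.End.mul_apply, tw₀_even, tw₁_odd,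
      tw₀_odd, h', map_sub, map_add, neg_smul, one_smul]
    noncomm_ring

theorem tw₁₁ : S.tw₁ z u * S.tw₁ z v = -(S.tw₁ z v * S.tw₁ z u) + S.tw₀ z (S.lie₁₁ u v) := by
  have h : ∀ q, S.adk₀p₀ (S.lie₁₁ u v) q = S.adk₁p₁ u (S.adk₁p₀ v q) + S.adk₁p₁ v (S.adk₁p₀ u q) :=
    fun q => by
      ext
      simp only [adk₀p₀, adk₁p₀, adk₁p₁, lie₁₁, LinearMap.coe_mk, AddHom.coe_mk, map_neg,
        Submodule.coe_add]
      rw [← lie_skew, lie_oddBracket, oddBracket_symm (⁅(q : 𝔤₀), (u : 𝔤₁)⁆)]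
      abel
  have h' : ∀ q, S.adk₀p₁ (S.lie₁₁ u v) q = S.adk₁p₀ u (S.adk₁p₁ v q) + S.adk₁p₀ v (S.adk₁p₁ u q) :=
    fun q => by
      ext
      simp only [adk₀p₁, adk₁p₀, adk₁p₁, lie₁₁, LinearMap.coe_mk, AddHom.coe_mk, Submodule.coe_add]
      have := oddBracket_cyclic (𝔤₀ := 𝔤₀) (u : 𝔤₁) v q
      rw [oddBracket_symm (q : 𝔤₁)] at this
      rw [add_assoc] at this
      rw [eq_neg_of_add_eq_zero_left this]
      abel
  refine sub_eq_zero.1 (eq_zero_of_gen _ 1 ?_ ?_ ?_)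
  · have e := S.tw₁_odd z u (S.adk₁p₀ v z) 1
    have e' := S.tw₁_odd z v (S.adk₁p₀ u z) 1
    simp only [mul_one, tw₁_one] at e e'
    simp only [LinearMap.sub_apply, LinearMap.add_apply, LinearMap.neg_apply, Module.End.mul_apply,
      tw₀_one, tw₁_one, h, map_add, e, e', odd_mul_odd (S.adk₁p₀ v z)]
    abel
  · intro q d
    simp only [LinearMap.sub_apply, LinearMap.add_apply, LinearMap.neg_apply, Module.End.mul_apply,
      tw₀_even, tw₁_even, tw₁_odd, h, map_add]
    noncomm_ring
  · intro q d
    simp only [LinearMap.sub_apply, LinearMap.add_apply, LinearMap.neg_apply, Module.End.mul_apply,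
      tw₀_odd, tw₁_even, tw₁_odd, h', map_sub, map_add, one_smul]
    noncomm_ring

end tw

/-! ### The enveloping algebra `U(𝔨)` -/

/-- The defining relations `x y - (-1)^{|x||y|} y x = [x, y]` of `U(𝔨)`. -/
inductive URel : TensorAlgebra ℂ (S.k₀ × S.k₁) → TensorAlgebra ℂ (S.k₀ × S.k₁) → Prop
  | even_even (x y : S.k₀) : URel
      (TensorAlgebra.ι ℂ (x, 0) * TensorAlgebra.ι ℂ (y, 0))
      (TensorAlgebra.ι ℂ (y, 0) * TensorAlgebra.ι ℂ (x, 0) + TensorAlgebra.ι ℂ (⁅x, y⁆, 0))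
  | even_odd (x : S.k₀) (u : S.k₁) : URel
      (TensorAlgebra.ι ℂ (x, 0) * TensorAlgebra.ι ℂ (0, u))
      (TensorAlgebra.ι ℂ (0, u) * TensorAlgebra.ι ℂ (x, 0) + TensorAlgebra.ι ℂ (0, S.lie₀₁ x u))
  | odd_odd (u v : S.k₁) : URel
      (TensorAlgebra.ι ℂ (0, u) * TensorAlgebra.ι ℂ (0, v))
      (-(TensorAlgebra.ι ℂ (0, v) * TensorAlgebra.ι ℂ (0, u)) + TensorAlgebra.ι ℂ (S.lie₁₁ u v, 0))

/-- The universal enveloping algebra `U(𝔨)` of the Lie superalgebra `𝔨 = 𝔨₀ ⊕ 𝔨₁`. -/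
abbrev Uk := RingQuot S.URel

/-- The canonical map `𝔨 → U(𝔨)`. -/
def ιk : S.k₀ × S.k₁ →ₗ[ℂ] S.Uk :=
  (RingQuot.mkAlgHom ℂ S.URel).toLinearMap ∘ₗ TensorAlgebra.ι ℂ

/-- The action `u_z` of `U(𝔨)` on `S(𝔭)`. -/
def twist (z : S.p₀) : S.Uk →ₐ[ℂ] Module.End ℂ S.Sp :=
  RingQuot.liftAlgHom ℂ ⟨TensorAlgebra.lift ℂ (S.tw z), by
    intro a b h
    cases h with
    | even_even x y => simpa [tw_even] using S.tw₀₀ z x y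
    | even_odd x u => simpa [tw_even, tw_odd] using S.tw₀₁ z x u
    | odd_odd u v => simpa [tw_even, tw_odd] using S.tw₁₁ z u v⟩

theorem twist_ι (z : S.p₀) (x : S.k₀ × S.k₁) : S.twist z (S.ιk x) = S.tw z x := by
  simp [twist, ιk]

/-- The supersymmetrisation map `β` on `⋀(𝔨₁) ⊆ S(𝔤)`, with values in `U(𝔨) ⊆ U(𝔤)`:
`β(u₁ ⋯ uₘ) = (1 / m!) ∑_σ sgn(σ) u_{σ(1)} ⋯ u_{σ(m)}`. -/
def β : ExteriorAlgebra ℂ S.k₁ →ₗ[ℂ] S.Uk :=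
  ExteriorAlgebra.liftAlternating fun m => ((m.factorial : ℂ)⁻¹) •
    MultilinearMap.alternatization ((MultilinearMap.mkPiAlgebraFin ℂ m S.Uk).compLinearMap
      fun _ => S.ιk ∘ₗ LinearMap.inr ℂ S.k₀ S.k₁)

/-! ### Radial parts -/

/-- `Γ_z : ⋀(𝔭₁) ⊗ S(𝔭₀) → S(𝔭)`, `q ⊗ p ↦ u_z(β([z, q])) p`, where `[z, ·] : ⋀(𝔭₁) → ⋀(𝔨₁)` is
the algebra homomorphism extending `ad z : 𝔭₁ → 𝔨₁`. -/
def Γ (z : S.p₀) : ExteriorAlgebra ℂ S.p₁ ⊗[ℂ] SymmetricAlgebra ℂ S.p₀ →ₗ[ℂ] S.Sp :=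
  TensorProduct.lift
    (LinearMap.lcomp ℂ S.Sp evenPart.toLinearMap ∘ₗ (S.twist z).toLinearMap ∘ₗ S.β ∘ₗ
      (ExteriorAlgebra.map (S.adp₀p₁ z)).toLinearMap)

/-- `ε ⊗ 1 : ⋀(𝔭₁) ⊗ S(𝔭₀) → S(𝔭₀)`, with `ε` the augmentation of `⋀(𝔭₁)`. -/
def augment : ExteriorAlgebra ℂ S.p₁ ⊗[ℂ] SymmetricAlgebra ℂ S.p₀ →ₗ[ℂ] SymmetricAlgebra ℂ S.p₀ :=
  (TensorProduct.lid ℂ _).toLinearMap ∘ₗ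
    TensorProduct.map ExteriorAlgebra.algebraMapInv.toLinearMap LinearMap.id

open Classical in
/-- The radial part `γ_z = (ε ⊗ 1) ∘ Γ_z⁻¹ : S(𝔭) → S(𝔭₀)`, meaningful when `Γ_z` is bijective
(otherwise it is set to `0`). -/
def γ (z : S.p₀) : S.Sp →ₗ[ℂ] SymmetricAlgebra ℂ S.p₀ :=
  if h : Function.Bijective (S.Γ z) then
    S.augment ∘ₗ (LinearEquiv.ofBijective (S.Γ z) h).symm.toLinearMap
  else 0

/-! ### Even Cartan subspaces and restricted roots -/

/-- An even Cartan subspace: a subspace `𝔞 ⊆ 𝔭₀` of semi-simple elements of `𝔤₀` with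
`𝔞 = 𝔷_𝔭(𝔞)`; the last condition is split into its even and odd parts. -/
structure IsEvenCartan (𝔞 : Submodule ℂ 𝔤₀) : Prop where
  le : 𝔞 ≤ S.p₀
  semisimple : ∀ h ∈ 𝔞, (LieAlgebra.ad ℂ 𝔤₀ h).IsSemisimple
  centralizer₀ : ∀ x ∈ S.p₀, (∀ h ∈ 𝔞, ⁅h, x⁆ = 0) ↔ x ∈ 𝔞
  centralizer₁ : ∀ u ∈ S.p₁, (∀ h ∈ 𝔞, ⁅h, u⁆ = 0) → u = 0

variable (𝔞 : Submodule ℂ 𝔤₀)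

/-- The joint eigenspace `{x ∈ M | [h, x] = l(h) x for all h ∈ 𝔞}` of a `𝔤₀`-module `M`; it is
`𝔤₀^l` for `M = 𝔤₀` and `𝔤₁^l` for `M = 𝔤₁`. -/
def weightSpace (M : Type*) [AddCommGroup M] [Module ℂ M] [LieRingModule 𝔤₀ M] [LieModule ℂ 𝔤₀ M]
    (l : Module.Dual ℂ 𝔞) : Submodule ℂ M where
  carrier := {x | ∀ h : 𝔞, ⁅(h : 𝔤₀), x⁆ = l h • x}
  add_mem' hx hy h := by rw [lie_add, hx h, hy h, smul_add]
  zero_mem' h := by simp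
  smul_mem' c x hx h := by rw [lie_smul, hx h, smul_comm]

/-- The non-zero weights of `𝔞` in `M`: the set `Σ₀` of even restricted roots for `M = 𝔤₀`, and the
set `Σ₁` of odd restricted roots for `M = 𝔤₁`. -/
def restrictedRoots (M : Type*) [AddCommGroup M] [Module ℂ M] [LieRingModule 𝔤₀ M]
    [LieModule ℂ 𝔤₀ M] : Set (Module.Dual ℂ 𝔞) :=
  {l | l ≠ 0 ∧ weightSpace 𝔞 M l ≠ ⊥}

variable (𝔤₁) in
/-- `Σ⁺ ⊆ Σ = Σ₀ ∪ Σ₁` such that `Σ` is the disjoint union of `Σ⁺` and `-Σ⁺`. -/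
def IsPositiveSystem (P : Set (Module.Dual ℂ 𝔞)) : Prop :=
  P ∪ {l | -l ∈ P} = restrictedRoots 𝔞 𝔤₀ ∪ restrictedRoots 𝔞 𝔤₁ ∧ Disjoint P {l | -l ∈ P}

variable (𝔤₁) in
/-- The set of all `l ∈ Σ₁` such that neither `l` nor `2 l` belongs to `Σ₀`. -/
def barRestrictedRoots₁ : Set (Module.Dual ℂ 𝔞) :=
  {l | l ∈ restrictedRoots 𝔞 𝔤₁ ∧ l ∉ restrictedRoots 𝔞 𝔤₀ ∧
    (2 : ℂ) • l ∉ restrictedRoots 𝔞 𝔤₀}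

/-- The vector `A_l ∈ 𝔞` with `b(A_l, h) = l(h)` for all `h ∈ 𝔞`. -/
def A (l : Module.Dual ℂ 𝔞) : 𝔞 :=
  Classical.epsilon fun a : 𝔞 => ∀ h : 𝔞, S.b₀ a h = l h

/-- `𝔨₁^l`, the `θ`-fixed part of `𝔤₁^l ⊕ 𝔤₁^{-l}`. -/
def kl (l : Module.Dual ℂ 𝔞) : Submodule ℂ 𝔤₁ :=
  S.k₁ ⊓ (weightSpace 𝔞 𝔤₁ l ⊔ weightSpace 𝔞 𝔤₁ (-l))

/-- `𝔭₁^l`, the `-1`-eigenspace of `θ` in `𝔤₁^l ⊕ 𝔤₁^{-l}`. -/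
def pl (l : Module.Dual ℂ 𝔞) : Submodule ℂ 𝔤₁ :=
  S.p₁ ⊓ (weightSpace 𝔞 𝔤₁ l ⊔ weightSpace 𝔞 𝔤₁ (-l))

/-- Compatible symplectic bases `y i, y' i` of `𝔨₁^l` and `z i, z' i` of `𝔭₁^l`, `i < n`
(so `n` is half the odd multiplicity of `l`). Linear independence follows from the values of `b`. -/
structure SymplecticBases (l : Module.Dual ℂ 𝔞) (n : ℕ) where
  y : Fin n → S.k₁
  y' : Fin n → S.k₁
  z : Fin n → S.p₁
  z' : Fin n → S.p₁
  span_y : Submodule.span ℂ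
    (Set.range (fun i => (y i : 𝔤₁)) ∪ Set.range (fun i => (y' i : 𝔤₁))) = S.kl 𝔞 l
  span_z : Submodule.span ℂ
    (Set.range (fun i => (z i : 𝔤₁)) ∪ Set.range (fun i => (z' i : 𝔤₁))) = S.pl 𝔞 l
  b_y_y' : ∀ i j, S.b₁ (y i) (y' j) = if i = j then 1 else 0
  b_z'_z : ∀ i j, S.b₁ (z' j) (z i) = if i = j then 1 else 0
  b_y_y : ∀ i j, S.b₁ (y i) (y j) = 0
  b_y'_y' : ∀ i j, S.b₁ (y' i) (y' j) = 0
  b_z_z : ∀ i j, S.b₁ (z i) (z j) = 0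
  b_z'_z' : ∀ i j, S.b₁ (z' i) (z' j) = 0
  x_mem : ∀ i, (y i : 𝔤₁) + z i ∈ weightSpace 𝔞 𝔤₁ l
  x'_mem : ∀ i, (y' i : 𝔤₁) + z' i ∈ weightSpace 𝔞 𝔤₁ l

/-- The monomial `z_I z'_I = z_{I 0} ⋯ z_{I (k-1)} z'_{I 0} ⋯ z'_{I (k-1)}` in `S(𝔭)`. -/
def SymplecticBases.monomial {S : SymmetricSuperpair 𝔤₀ 𝔤₁} {𝔞 : Submodule ℂ 𝔤₀}
    {l : Module.Dual ℂ 𝔞} {n : ℕ} (B : S.SymplecticBases 𝔞 l n) {k : ℕ} (I : Fin k → Fin n) :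
    S.Sp :=
  (List.ofFn fun j => odd (B.z (I j))).prod * (List.ofFn fun j => odd (B.z' (I j))).prod

end SymmetricSuperpair

end

/-! `Γ_h` is bijective because `u_h(y)` is multiplication by `[y, h]`, which raises the degree in
`S(𝔭)` by one, plus `ad y`, which preserves it. Hence, up to lower degree, `Γ_h` acts on odd factors
by `-(ad h)²`. Odd regularity makes `ad h` injective on `𝔭₁` by invariance of `b`, and `(ad h)²` is
then injective too because `h` acts diagonalizably on the semisimple module `𝔤₁` (`Γ_bijective`).

Since `2λ` is not an even root, `𝔤₁^λ` has zero bracket with itself. For `y + z`, `y' + z'` in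
`𝔤₁^λ` this gives `[y, z'] = -b(y, y') A_λ`, and `[y, y']` commutes with `𝔞`. So `u_h([y, y'])`
kills polynomials in `A_λ`, and reordering a word in operators `u_h(y)` applied to such a polynomial
costs only shorter nonempty words. As `γ_h` kills antisymmetrised words of positive length, it kills
all these words by induction (`γ_eq_zero_of_mem_wordSpan`).

Every product of elements `z` with a polynomial in `A_λ` is a combination of words
(`mul_mem_iSup_rootWordSpan`). Let `Z_J` be the product of the `zⱼ z'ⱼ`, `j ∈ J`, and `s =
λ(A_λ)/λ(h)`. Applying `γ_h` to `u_h(yᵢ)(z'ᵢ Z_J P(A_λ))`, for `i ∉ J`, gives the recursion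
`γ_pairProd_cons`: `γ_h(zᵢ z'ᵢ Z_J (P + s P')(A_λ)) = -λ(h)⁻¹ γ_h(Z_J A_λ P(A_λ))`. The Bessel
polynomials satisfy `B_{k+1} + s B_{k+1}' = X B_k`, so each use of the recursion removes a pair and
turns `X B_k` into `X B_{k+1}`. The remaining sign comes from sorting `z_I z'_I` into pairs. -/

/-! ### Diagonalizable actions. -/

/-- An element acting semisimply in the adjoint representation acts diagonalizably in every
semisimple finite-dimensional representation. -/
theorem LieModule.iSup_eigenspace_toEnd_eq_top {L M : Type*} [LieRing L] [LieAlgebra ℂ L]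
    [FiniteDimensional ℂ L] [AddCommGroup M] [Module ℂ M] [FiniteDimensional ℂ M]
    [LieRingModule L M] [LieModule ℂ L M] [ComplementedLattice (LieSubmodule ℂ L M)] (h : L)
    (hh : (LieAlgebra.ad ℂ L h).IsSemisimple) :
    ⨆ μ : ℂ, (LieModule.toEnd ℂ L M h).eigenspace μ = ⊤ := by
  set T := LieModule.toEnd ℂ L M h with hT
  -- An `α`-eigenvector of `ad h` maps the `μ`-eigenspace into the `(α + μ)`-eigenspace, so the sum
  -- of eigenspaces is a submodule.
  have key : ∀ (x : L) (m : M), m ∈ ⨆ μ : ℂ, T.eigenspace μ → ⁅x, m⁆ ∈ ⨆ μ : ℂ, T.eigenspace μ := by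
    intro x m hm
    have hx : x ∈ ⨆ μ : ℂ, (LieAlgebra.ad ℂ L h).eigenspace μ := by
      rw [hh.iSup_eigenspace_eq_top]; trivial
    induction hx using Submodule.iSup_induction' with
    | zero => simp
    | add x y _ _ hx hy => rw [add_lie]; exact add_mem hx hy
    | mem α x hx =>
      induction hm using Submodule.iSup_induction' with
      | zero => simp
      | add m m' _ _ hm hm' => rw [lie_add]; exact add_mem hm hm'
      | mem μ m hm =>
        refine Submodule.mem_iSup_of_mem (α + μ) ?_
        rw [Module.End.mem_eigenspace_iff] at hx hm ⊢
        rw [LieAlgebra.ad_apply] at hx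
        rw [hT, LieModule.toEnd_apply_apply] at hm ⊢
        rw [leibniz_lie, hx, hm, smul_lie, lie_smul, add_smul]
  let N : LieSubmodule ℂ L M :=
    { (⨆ μ : ℂ, T.eigenspace μ : Submodule ℂ M) with lie_mem := fun {x m} hm => key x m hm }
  -- A nonzero complement would be `h`-stable, hence contain an eigenvector, which already lies in
  -- `N`.
  obtain ⟨N', hN'⟩ := exists_isCompl N
  have hbot : N' = ⊥ := by
    by_contra hne
    have hmaps : Set.MapsTo T (N' : Submodule ℂ M) (N' : Submodule ℂ M) :=
      fun m hm => N'.lie_mem hm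
    have : Nontrivial (N' : Submodule ℂ M) := by
      rw [Submodule.nontrivial_iff_ne_bot]
      simpa using hne
    obtain ⟨μ, hμ⟩ := Module.End.exists_eigenvalue (T.restrict hmaps)
    obtain ⟨v, hv, hv0⟩ := hμ.exists_hasEigenvector
    rw [Module.End.mem_eigenspace_iff] at hv
    have hv' : T v = μ • (v : M) := congrArg Subtype.val hv
    have h1 : (v : M) ∈ N := Submodule.mem_iSup_of_mem μ (Module.End.mem_eigenspace_iff.2 hv')
    have h2 : (v : M) ∈ N ⊓ N' := (LieSubmodule.mem_inf _ _ _).2 ⟨h1, v.2⟩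
    rw [hN'.inf_eq_bot, LieSubmodule.mem_bot] at h2
    exact hv0 (Subtype.ext h2)
  have htop : N = ⊤ := by simpa [hbot] using hN'.sup_eq_top
  exact congrArg LieSubmodule.toSubmodule htop

/-- A diagonalizable endomorphism has the same kernel as its square. -/
theorem Module.End.apply_eq_zero_of_apply_apply_eq_zero {V : Type*} [AddCommGroup V] [Module ℂ V]
    [FiniteDimensional ℂ V] {T : Module.End ℂ V} (hT : ⨆ μ : ℂ, T.eigenspace μ = ⊤) {v : V}
    (hv : T (T v) = 0) : T v = 0 := by
  have hv' : v ∈ T.eigenspace 0 ⊔ ⨆ (μ : ℂ) (_ : μ ≠ 0), T.eigenspace μ := by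
    have : (⨆ μ : ℂ, T.eigenspace μ) ≤ T.eigenspace 0 ⊔ ⨆ (μ : ℂ) (_ : μ ≠ 0), T.eigenspace μ := by
      refine iSup_le fun μ => ?_
      by_cases hμ : μ = 0
      · exact hμ ▸ le_sup_left
      · exact le_sup_of_le_right (le_iSup₂_of_le μ hμ le_rfl)
    exact this (hT ▸ Submodule.mem_top)
  obtain ⟨v₀, h₀, w, hw, rfl⟩ := Submodule.mem_sup.1 hv'
  rw [Module.End.eigenspace_zero, LinearMap.mem_ker] at h₀
  rw [map_add, h₀, zero_add] at hv ⊢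
  -- `w` is a sum of eigenvectors with nonzero eigenvalues, yet `T² w = 0`; independence of
  -- generalized eigenspaces forces `w = 0`.
  have h1 : w ∈ T.maxGenEigenspace 0 :=
    (Module.End.mem_maxGenEigenspace _ _ _).2 ⟨2, by rw [zero_smul, sub_zero, pow_two]; exact hv⟩
  have h2 : w ∈ ⨆ (μ : ℂ) (_ : μ ≠ 0), T.maxGenEigenspace μ :=
    (iSup₂_mono fun μ _ => (T.genEigenspace μ).mono le_top) hw
  rw [Submodule.disjoint_def.1 (T.independent_maxGenEigenspace 0) w h1 h2, map_zero]

namespace SymmetricSuperpair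

open LieSuperalgebra SuperSym

variable {𝔤₀ 𝔤₁ : Type*} [LieRing 𝔤₀] [LieAlgebra ℂ 𝔤₀] [AddCommGroup 𝔤₁]
    [Module ℂ 𝔤₁] [LieRingModule 𝔤₀ 𝔤₁] [LieModule ℂ 𝔤₀ 𝔤₁] [LieSuperalgebra 𝔤₀ 𝔤₁]
    (S : SymmetricSuperpair 𝔤₀ 𝔤₁)

theorem b₀_lie (x y z : 𝔤₀) : S.b₀ ⁅x, y⁆ z = -S.b₀ y ⁅x, z⁆ := by
  rw [← lie_skew, map_neg, LinearMap.neg_apply, S.b_invariant₀₀₀]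

theorem b₁_lie (x : 𝔤₀) (u v : 𝔤₁) : S.b₁ ⁅x, u⁆ v = -S.b₁ u ⁅x, v⁆ := by
  rw [← S.b_invariant₁₀₁, map_neg, LinearMap.neg_apply, neg_neg]

theorem b₀_p_k {x y : 𝔤₀} (hx : x ∈ S.p₀) (hy : S.θ₀ y = y) : S.b₀ x y = 0 := by
  have h := S.b₀_θ₀ x y
  rw [show S.θ₀ x = -x from hx, hy, map_neg, LinearMap.neg_apply] at h
  exact self_eq_neg.1 h.symm

theorem b₁_p_k {u v : 𝔤₁} (hu : u ∈ S.p₁) (hv : v ∈ S.k₁) : S.b₁ u v = 0 := by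
  have h := S.b₁_θ₁ u v
  rw [show S.θ₁ u = -u from hu, show S.θ₁ v = v from hv, map_neg, LinearMap.neg_apply] at h
  exact self_eq_neg.1 h.symm

theorem exists_k₀_add_p₀ (x : 𝔤₀) : ∃ y z, S.θ₀ y = y ∧ z ∈ S.p₀ ∧ x = y + z := by
  refine ⟨(2 : ℂ)⁻¹ • (x + S.θ₀ x), (2 : ℂ)⁻¹ • (x - S.θ₀ x), ?_, ?_, ?_⟩
  · rw [map_smul, map_add, S.θ₀_θ₀, add_comm]
  · change S.θ₀ _ = -_
    rw [map_smul, map_sub, S.θ₀_θ₀, ← smul_neg, neg_sub]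
  · rw [← smul_add, add_add_sub_cancel, ← two_smul ℂ x, smul_smul]; norm_num

theorem exists_k₁_add_p₁ (u : 𝔤₁) : ∃ y ∈ S.k₁, ∃ z ∈ S.p₁, u = y + z := by
  refine ⟨(2 : ℂ)⁻¹ • (u + S.θ₁ u), ?_, (2 : ℂ)⁻¹ • (u - S.θ₁ u), ?_, ?_⟩
  · change S.θ₁ _ = _
    rw [map_smul, map_add, S.θ₁_θ₁, add_comm]
  · change S.θ₁ _ = -_
    rw [map_smul, map_sub, S.θ₁_θ₁, ← smul_neg, neg_sub]
  · rw [← smul_add, add_add_sub_cancel, ← two_smul ℂ u, smul_smul]; norm_num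

variable {S} in
-- By invariance, `ad z : 𝔭₁ → 𝔨₁` is minus the transpose of `ad z : 𝔨₁ → 𝔭₁`, and `b` pairs `𝔭₁`
-- trivially with `𝔨₁`.
theorem IsOddlyRegular.adp₀p₁_injective {z : S.p₀} (hz : S.IsOddlyRegular z) :
    Function.Injective (S.adp₀p₁ z) := by
  rw [injective_iff_map_eq_zero]
  intro w hw
  have hw' : ⁅(z : 𝔤₀), (w : 𝔤₁)⁆ = 0 := congrArg Subtype.val hw
  refine Subtype.ext (S.b₁_nondegenerate _ fun v => ?_)
  obtain ⟨y, hy, v', hv', rfl⟩ := S.exists_k₁_add_p₁ v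
  obtain ⟨u, hu⟩ := hz ⟨v', hv'⟩
  have hu' : ⁅(z : 𝔤₀), (u : 𝔤₁)⁆ = v' := congrArg Subtype.val hu
  have h := S.b₁_lie z w u
  rw [hw', map_zero, LinearMap.zero_apply, hu', zero_eq_neg] at h
  rw [map_add, S.b₁_p_k w.2 hy, h, add_zero]

/-! ### The form and the operators `ad h` for an even Cartan subspace. -/

section Cartan

variable {S} {𝔞 : Submodule ℂ 𝔤₀}

theorem IsEvenCartan.lie_eq_zero (h𝔞 : S.IsEvenCartan 𝔞) {x y : 𝔤₀} (hx : x ∈ 𝔞) (hy : y ∈ 𝔞) : ⁅x, y⁆ = 0 :=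
  (h𝔞.centralizer₀ y (h𝔞.le hy)).2 hy x hx

/-- The restriction of the invariant form to an even Cartan subspace is non-degenerate. -/
theorem IsEvenCartan.eq_zero_of_b₀ [FiniteDimensional ℂ 𝔤₀] (h𝔞 : S.IsEvenCartan 𝔞) {a : 𝔤₀} (ha : a ∈ 𝔞)
    (hb : ∀ h ∈ 𝔞, S.b₀ a h = 0) : a = 0 := by
  refine S.b₀_nondegenerate a fun x => ?_
  -- `𝔤₀` is the sum of joint eigenspaces of the commuting operators `ad h`. The zero weight space
  -- reduces to its `𝔭₀`-part, which is `𝔞`; the nonzero weights are orthogonal to `𝔞`.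
  have htop : ⨆ χ : 𝔞 → ℂ, ⨅ h : 𝔞, (LieAlgebra.ad ℂ 𝔤₀ (h : 𝔤₀)).maxGenEigenspace (χ h) = ⊤ := by
    refine Module.End.iSup_iInf_maxGenEigenspace_eq_top_of_iSup_maxGenEigenspace_eq_top_of_commute
      _ ?_ fun _ => Module.End.iSup_maxGenEigenspace_eq_top _
    intro h h' _
    refine LinearMap.ext fun x => ?_
    have := leibniz_lie (h : 𝔤₀) (h' : 𝔤₀) x
    rw [h𝔞.lie_eq_zero h.2 h'.2, zero_lie, zero_add] at this
    exact this
  have hx : x ∈ ⨆ χ : 𝔞 → ℂ,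
      ⨅ h : 𝔞, (LieAlgebra.ad ℂ 𝔤₀ (h : 𝔤₀)).maxGenEigenspace (χ h) := by rw [htop]; trivial
  induction hx using Submodule.iSup_induction' with
  | zero => simp
  | add x y _ _ hx hy => rw [map_add, hx, hy, add_zero]
  | mem χ x hx =>
    have hx' : ∀ h : 𝔞, ⁅(h : 𝔤₀), x⁆ = χ h • x := fun h => by
      have := (Submodule.mem_iInf _).1 hx h
      rw [(h𝔞.semisimple h h.2).isFinitelySemisimple.maxGenEigenspace_eq_eigenspace,
        Module.End.mem_eigenspace_iff] at this
      exact this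
    by_cases hχ : ∀ h, χ h = 0
    · obtain ⟨y, z, hy, hz, rfl⟩ := S.exists_k₀_add_p₀ x
      rw [map_add, S.b₀_p_k (h𝔞.le ha) hy, zero_add]
      refine hb z ((h𝔞.centralizer₀ z hz).1 fun h hh => ?_)
      have h1 : ⁅h, y + z⁆ = 0 := by simpa [hχ] using hx' ⟨h, hh⟩
      -- Applying `θ` shows that the `𝔭₀`-component of a zero weight vector commutes with `𝔞` on its
      -- own.
      have h2 : ⁅h, y - z⁆ = 0 := by
        have := congrArg S.θ₀ h1
        rw [S.θ₀_lie, map_add, hy, show S.θ₀ z = -z from hz,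
          show S.θ₀ h = -h from h𝔞.le hh, map_zero, neg_lie, neg_eq_zero, ← sub_eq_add_neg] at this
        exact this
      have h3 : (2 : ℂ) • ⁅h, z⁆ = 0 := by
        have : y + z - (y - z) = z + z := by abel
        rw [two_smul, ← lie_add, ← this, lie_sub, h1, h2, sub_zero]
      exact (smul_eq_zero.1 h3).resolve_left two_ne_zero
    · push Not at hχ
      obtain ⟨h, hh⟩ := hχ
      have := S.b₀_lie h a x
      rw [h𝔞.lie_eq_zero h.2 ha, hx', map_zero, LinearMap.zero_apply, map_smul, smul_eq_mul,
        zero_eq_neg] at this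
      exact (mul_eq_zero.1 this).resolve_left hh

/-- The form embeds `𝔞` into its dual, so a dimension count supplies the vector that `A` selects. -/
theorem IsEvenCartan.b₀_A [FiniteDimensional ℂ 𝔤₀] (h𝔞 : S.IsEvenCartan 𝔞) (l : Module.Dual ℂ 𝔞) (h : 𝔞) :
    S.b₀ (S.A 𝔞 l) h = l h := by
  suffices hex : ∃ a : 𝔞, ∀ h : 𝔞, S.b₀ a h = l h from Classical.epsilon_spec hex h
  let f : 𝔞 →ₗ[ℂ] Module.Dual ℂ 𝔞 := (S.b₀.domRestrict₁₂ 𝔞 𝔞)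
  have hf : Function.Injective f := by
    rw [injective_iff_map_eq_zero]
    intro a ha
    exact Subtype.ext (h𝔞.eq_zero_of_b₀ a.2 fun h hh => LinearMap.congr_fun ha ⟨h, hh⟩)
  have hsurj : Function.Surjective f :=
    (LinearMap.injective_iff_surjective_of_finrank_eq_finrank
      (Subspace.dual_finrank_eq (K := ℂ) (V := 𝔞)).symm).1 hf
  obtain ⟨a, ha⟩ := hsurj l
  exact ⟨a, fun h => LinearMap.congr_fun ha h⟩

theorem IsEvenCartan.adp₀k₁_adp₀p₁_injective [FiniteDimensional ℂ 𝔤₀] [FiniteDimensional ℂ 𝔤₁]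
    (h𝔞 : S.IsEvenCartan 𝔞) (hS : S.IsReductive) (h : 𝔞)
    (hh : S.IsOddlyRegular (Submodule.inclusion h𝔞.le h)) :
    Function.Injective (S.adp₀k₁ (Submodule.inclusion h𝔞.le h) ∘ₗ
      S.adp₀p₁ (Submodule.inclusion h𝔞.le h)) := by
  rw [injective_iff_map_eq_zero]
  intro w hw
  have := hS.semisimple₁
  have hw' : ⁅(h : 𝔤₀), ⁅(h : 𝔤₀), (w : 𝔤₁)⁆⁆ = 0 := congrArg Subtype.val hw
  refine hh.adp₀p₁_injective ?_
  rw [map_zero]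
  exact Subtype.ext (Module.End.apply_eq_zero_of_apply_apply_eq_zero
    (LieModule.iSup_eigenspace_toEnd_eq_top (M := 𝔤₁) (h : 𝔤₀) (h𝔞.semisimple h h.2)) hw')

end Cartan

end SymmetricSuperpair

/-! ### The degree filtration and the bijectivity of `Γ`. -/

/-- A locally nilpotent perturbation of the identity is bijective. -/
theorem LinearMap.bijective_of_locally_nilpotent {V : Type*} [AddCommGroup V] [Module ℂ V]
    (E : Module.End ℂ V) (hE : ∀ a, ∃ n : ℕ, ((E - 1) ^ n) a = 0) : Function.Bijective E := by
  constructor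
  · rw [injective_iff_map_eq_zero]
    intro a ha
    -- On the kernel of `E`, the nilpotent part acts as `-1`.
    have h : ∀ n : ℕ, ((E - 1) ^ n) a = (-1 : ℂ) ^ n • a := by
      intro n
      induction n with
      | zero => simp
      | succ n ih =>
        rw [pow_succ', Module.End.mul_apply, ih, map_smul, LinearMap.sub_apply, ha, zero_sub,
          Module.End.one_apply, pow_succ, mul_smul, neg_one_smul]
    obtain ⟨n, hn⟩ := hE a
    rw [h, smul_eq_zero] at hn
    exact hn.resolve_left (pow_ne_zero _ (by norm_num))
  · intro a
    obtain ⟨n, hn⟩ := hE a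
    induction n generalizing a with
    | zero => exact ⟨0, by simpa using hn.symm⟩
    | succ n ih =>
      rw [pow_succ, Module.End.mul_apply] at hn
      obtain ⟨b, hb⟩ := ih _ hn
      -- From `E b = (E - 1) a` one gets `E (a - b) = a`.
      exact ⟨a - b, by rw [map_sub, hb, LinearMap.sub_apply, Module.End.one_apply, sub_sub_cancel]⟩

namespace SuperSym

variable {V W : Type*} [AddCommGroup V] [Module ℂ V] [AddCommGroup W] [Module ℂ W]

variable (V W) in
/-- The filtration of `S(V ⊕ W)` by total degree. -/
def filtration (n : ℕ) : Submodule ℂ (SuperSym V W) :=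
  (1 ⊔ LinearMap.range even ⊔ LinearMap.range odd : Submodule ℂ (SuperSym V W)) ^ n

variable (V W) in
/-- The elements of degree `< n`. -/
def degreeLT : ℕ → Submodule ℂ (SuperSym V W)
  | 0 => ⊥
  | n + 1 => filtration V W n

/-- An induction principle: the degree filtration is the smallest increasing one containing `1` in
which multiplication by a generator costs one step. -/
theorem filtration_le {G : ℕ → Submodule ℂ (SuperSym V W)} (h1 : 1 ∈ G 0)
    (hmono : ∀ n, G n ≤ G (n + 1)) (he : ∀ n v, ∀ a ∈ G n, even v * a ∈ G (n + 1))
    (ho : ∀ n w, ∀ a ∈ G n, odd w * a ∈ G (n + 1)) (n : ℕ) : filtration V W n ≤ G n := by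
  induction n with
  | zero => rwa [filtration, pow_zero, Submodule.one_le]
  | succ n ih =>
    rw [filtration, pow_succ', Submodule.mul_le]
    intro g hg a ha
    have ha := ih ha
    obtain ⟨g', hg', _, ⟨w, rfl⟩, rfl⟩ := Submodule.mem_sup.1 hg
    obtain ⟨c, hc, _, ⟨v, rfl⟩, rfl⟩ := Submodule.mem_sup.1 hg'
    obtain ⟨c, rfl⟩ := Submodule.mem_one.1 hc
    rw [add_mul, add_mul, ← Algebra.smul_def]
    exact add_mem (add_mem ((G (n + 1)).smul_mem c (hmono n ha)) (he n v a ha)) (ho n w a ha)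

theorem one_mem_filtration : (1 : SuperSym V W) ∈ filtration V W 0 := by
  rw [filtration, pow_zero]; exact Submodule.one_le.1 le_rfl

theorem mul_mem_filtration_succ {g a : SuperSym V W} {n : ℕ}
    (hg : g ∈ (1 ⊔ LinearMap.range even ⊔ LinearMap.range odd : Submodule ℂ (SuperSym V W)))
    (ha : a ∈ filtration V W n) : g * a ∈ filtration V W (n + 1) := by
  rw [filtration, pow_succ']
  exact Submodule.mul_mem_mul hg ha

theorem filtration_le_succ (n : ℕ) : filtration V W n ≤ filtration V W (n + 1) := fun a ha => by
  rw [← one_mul a]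
  exact mul_mem_filtration_succ
    (Submodule.mem_sup_left (Submodule.mem_sup_left (Submodule.one_le.1 le_rfl))) ha

theorem even_mul_mem_filtration (v : V) {a : SuperSym V W} {n : ℕ} (ha : a ∈ filtration V W n) :
    even v * a ∈ filtration V W (n + 1) :=
  mul_mem_filtration_succ (Submodule.mem_sup_left (Submodule.mem_sup_right ⟨v, rfl⟩)) ha

theorem odd_mul_mem_filtration (w : W) {a : SuperSym V W} {n : ℕ} (ha : a ∈ filtration V W n) :
    odd w * a ∈ filtration V W (n + 1) :=
  mul_mem_filtration_succ (Submodule.mem_sup_right ⟨w, rfl⟩) ha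

theorem exists_mem_filtration (a : SuperSym V W) : ∃ n, a ∈ filtration V W n := by
  induction a using induction with
  | h1 => exact ⟨0, one_mem_filtration⟩
  | hadd a b ha hb =>
    obtain ⟨m, hm⟩ := ha
    obtain ⟨n, hn⟩ := hb
    have hmono := monotone_nat_of_le_succ (filtration_le_succ (V := V) (W := W))
    exact ⟨m + n, add_mem (hmono (Nat.le_add_right m n) hm) (hmono (Nat.le_add_left n m) hn)⟩
  | hsmul c a ha => exact ha.imp fun n hn => Submodule.smul_mem _ c hn
  | he v a ha => exact ha.elim fun n hn => ⟨n + 1, even_mul_mem_filtration v hn⟩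
  | ho w a ha => exact ha.elim fun n hn => ⟨n + 1, odd_mul_mem_filtration w hn⟩

theorem degreeLT_le_filtration (n : ℕ) : degreeLT V W n ≤ filtration V W n := by
  cases n with
  | zero => exact bot_le
  | succ n => exact filtration_le_succ n

theorem degreeLT_le_succ (n : ℕ) : degreeLT V W n ≤ degreeLT V W (n + 1) :=
  degreeLT_le_filtration n

theorem odd_mul_mem_degreeLT (w : W) {a : SuperSym V W} {n : ℕ} (ha : a ∈ degreeLT V W n) :
    odd w * a ∈ degreeLT V W (n + 1) := by
  cases n with
  | zero => rw [(Submodule.mem_bot _).1 ha, mul_zero]; exact zero_mem _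
  | succ n => exact odd_mul_mem_filtration w ha

theorem oddPart_ιMulti {m : ℕ} (w : Fin m → W) :
    (oddPart (ExteriorAlgebra.ιMulti ℂ m w) : SuperSym V W)
      = (List.ofFn fun i => odd (w i)).prod := by
  rw [ExteriorAlgebra.ιMulti_apply, map_list_prod, List.map_ofFn]
  rfl

variable (V W) in
/-- The span of the products of `i` even and `m` odd factors with `i + m ≤ n`. -/
def monomialSpan (n : ℕ) : Submodule ℂ (SuperSym V W) :=
  Submodule.span ℂ {a | ∃ (i m : ℕ) (p : SymmetricAlgebra ℂ V) (w : Fin m → W), i + m ≤ n ∧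
    (evenPart p : SuperSym V W) ∈ filtration V W i ∧
    a = evenPart p * oddPart (ExteriorAlgebra.ιMulti ℂ m w)}

theorem filtration_le_monomialSpan (n : ℕ) : filtration V W n ≤ monomialSpan V W n := by
  refine filtration_le ?_ ?_ ?_ ?_ n
  · refine Submodule.subset_span ⟨0, 0, 1, ![], le_rfl, ?_, ?_⟩
    · rw [map_one]; exact one_mem_filtration
    · simp
  · intro n
    refine Submodule.span_mono ?_
    rintro _ ⟨i, m, p, w, hn, hp, rfl⟩
    exact ⟨i, m, p, w, hn.trans n.le_succ, hp, rfl⟩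
  · intro n v a ha
    induction ha using Submodule.span_induction with
    | zero => simp
    | add a b _ _ ha hb => rw [mul_add]; exact add_mem ha hb
    | smul c a _ ha => rw [mul_smul_comm]; exact Submodule.smul_mem _ c ha
    | mem a ha =>
      obtain ⟨i, m, p, w, hn, hp, rfl⟩ := ha
      have h : (even v : SuperSym V W) * evenPart p
          = evenPart (SymmetricAlgebra.ι ℂ V v * p) := by rw [map_mul]; rfl
      exact Submodule.subset_span ⟨i + 1, m, SymmetricAlgebra.ι ℂ V v * p, w, by omega,
        h ▸ even_mul_mem_filtration v hp, by rw [← h, mul_assoc]⟩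
  · intro n w' a ha
    induction ha using Submodule.span_induction with
    | zero => simp
    | add a b _ _ ha hb => rw [mul_add]; exact add_mem ha hb
    | smul c a _ ha => rw [mul_smul_comm]; exact Submodule.smul_mem _ c ha
    | mem a ha =>
      obtain ⟨i, m, p, w, hn, hp, rfl⟩ := ha
      refine Submodule.subset_span ⟨i, m + 1, p, Fin.cons w' w, by omega, hp, ?_⟩
      rw [← mul_assoc, ← evenPart_mul_comm, mul_assoc, oddPart_ιMulti, oddPart_ιMulti]
      simp

end SuperSym

namespace SymmetricSuperpair

open LieSuperalgebra SuperSym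

variable {𝔤₀ 𝔤₁ : Type*} [LieRing 𝔤₀] [LieAlgebra ℂ 𝔤₀] [AddCommGroup 𝔤₁]
    [Module ℂ 𝔤₁] [LieRingModule 𝔤₀ 𝔤₁] [LieModule ℂ 𝔤₀ 𝔤₁] [LieSuperalgebra 𝔤₀ 𝔤₁]
    (S : SymmetricSuperpair 𝔤₀ 𝔤₁)

theorem twist_β_ιMulti (z : S.p₀) {m : ℕ} (u : Fin m → S.k₁) :
    S.twist z (S.β (ExteriorAlgebra.ιMulti ℂ m u)) =
      ((m.factorial : ℂ)⁻¹) • ∑ σ : Equiv.Perm (Fin m),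
        Equiv.Perm.sign σ • (List.ofFn fun i => S.tw₁ z (u (σ i))).prod := by
  rw [β, ExteriorAlgebra.liftAlternating_apply_ιMulti, AlternatingMap.smul_apply,
    MultilinearMap.alternatization_apply, map_smul, map_sum]
  congr 1
  refine Finset.sum_congr rfl fun σ _ => ?_
  rw [Units.smul_def, Units.smul_def, map_zsmul, MultilinearMap.domDomCongr_apply,
    MultilinearMap.compLinearMap_apply, MultilinearMap.mkPiAlgebraFin_apply, map_list_prod,
    List.map_ofFn]
  congr 3
  funext i
  exact (S.twist_ι z _).trans (S.tw_odd z _)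

theorem Γ_tmul (z : S.p₀) (q : ExteriorAlgebra ℂ S.p₁) (p : SymmetricAlgebra ℂ S.p₀) :
    S.Γ z (q ⊗ₜ p) = S.twist z (S.β (ExteriorAlgebra.map (S.adp₀p₁ z) q)) (evenPart p) := rfl

theorem ad₁_mem_filtration (u : S.k₁) {n : ℕ} {a : S.Sp} (ha : a ∈ filtration S.p₀ S.p₁ n) :
    S.ad₁ u a ∈ filtration S.p₀ S.p₁ n := by
  -- The Leibniz rule also produces the undifferentiated factor, so its degree bound has to be
  -- carried along.
  suffices h : filtration S.p₀ S.p₁ n ≤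
      filtration S.p₀ S.p₁ n ⊓ (filtration S.p₀ S.p₁ n).comap (S.ad₁ u) from (h ha).2
  refine filtration_le (G := fun n => filtration S.p₀ S.p₁ n ⊓
    (filtration S.p₀ S.p₁ n).comap (S.ad₁ u)) ⟨one_mem_filtration, ?_⟩ ?_ ?_ ?_ n
  · simp [ad₁, SuperSym.deriv_one]
  · exact fun n a ha => ⟨filtration_le_succ n ha.1, filtration_le_succ n ha.2⟩
  · intro n v a ha
    refine ⟨even_mul_mem_filtration v ha.1, ?_⟩
    rw [SetLike.mem_coe, Submodule.mem_comap, ad₁, deriv_even_mul]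
    exact add_mem (odd_mul_mem_filtration _ ha.1) (even_mul_mem_filtration v ha.2)
  · intro n w a ha
    refine ⟨odd_mul_mem_filtration w ha.1, ?_⟩
    rw [SetLike.mem_coe, Submodule.mem_comap, ad₁, deriv_odd_mul]
    exact add_mem (even_mul_mem_filtration _ ha.1)
      (Submodule.smul_mem _ _ (odd_mul_mem_filtration w ha.2))

/-- The leading term of a product of operators `u_z(u)`. -/
theorem prod_tw₁_sub_mem_degreeLT (z : S.p₀) {n : ℕ} {a : S.Sp} (ha : a ∈ filtration S.p₀ S.p₁ n)
    (us : List S.k₁) :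
    ((us.map fun u => odd (S.adk₁p₀ u z)).prod * a ∈ filtration S.p₀ S.p₁ (n + us.length)) ∧
      (us.map (S.tw₁ z)).prod a - (us.map fun u => odd (S.adk₁p₀ u z)).prod * a ∈
        degreeLT S.p₀ S.p₁ (n + us.length) := by
  induction us with
  | nil => simpa using ha
  | cons u us ih =>
    obtain ⟨h1, h2⟩ := ih
    simp only [List.map_cons, List.prod_cons, List.length_cons, ← add_assoc, mul_assoc,
      Module.End.mul_apply]
    refine ⟨odd_mul_mem_filtration _ h1, ?_⟩
    set x := (us.map (S.tw₁ z)).prod a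
    set y := (us.map fun u => odd (S.adk₁p₀ u z)).prod * a
    have hx : x ∈ filtration S.p₀ S.p₁ (n + us.length) := by
      simpa using add_mem (degreeLT_le_filtration _ h2) h1
    -- The first term has low degree by induction; the second because `ad u` does not raise the
    -- degree.
    have : S.tw₁ z u x - odd (S.adk₁p₀ u z) * y
        = odd (S.adk₁p₀ u z) * (x - y) + S.ad₁ u x := by
      rw [tw₁, LinearMap.add_apply, LinearMap.mulLeft_apply, mul_sub]; abel
    rw [this]
    exact add_mem (odd_mul_mem_degreeLT _ h2) (S.ad₁_mem_filtration u hx)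

/-- The leading term of each permuted word is a product of anticommuting elements, so the sign
absorbs the permutation and the average has the same leading term. -/
theorem Γ_sub_mem_degreeLT (z : S.p₀) {n m : ℕ} {p : SymmetricAlgebra ℂ S.p₀}
    (hp : (evenPart p : S.Sp) ∈ filtration S.p₀ S.p₁ n) (v w : Fin m → S.p₁)
    (hvw : ∀ i, S.adk₁p₀ (S.adp₀p₁ z (v i)) z = w i) :
    S.Γ z (ExteriorAlgebra.ιMulti ℂ m v ⊗ₜ p) -
      evenPart p * oddPart (ExteriorAlgebra.ιMulti ℂ m w) ∈ degreeLT S.p₀ S.p₁ (n + m) := by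
  have key : ∀ σ : Equiv.Perm (Fin m), Equiv.Perm.sign σ •
      (List.ofFn fun i => S.tw₁ z (S.adp₀p₁ z (v (σ i)))).prod (evenPart p) -
      evenPart p * oddPart (ExteriorAlgebra.ιMulti ℂ m w) ∈ degreeLT S.p₀ S.p₁ (n + m) := by
    intro σ
    have h := (S.prod_tw₁_sub_mem_degreeLT z hp
      (List.ofFn fun i => S.adp₀p₁ z (v (σ i)))).2
    rw [List.map_ofFn, List.map_ofFn, List.length_ofFn] at h
    have e : (List.ofFn ((fun u => (odd (S.adk₁p₀ u z) : S.Sp)) ∘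
        fun i => S.adp₀p₁ z (v (σ i)))).prod
        = Equiv.Perm.sign σ • oddPart (ExteriorAlgebra.ιMulti ℂ m w) := by
      rw [Units.smul_def, ← map_zsmul, ← Units.smul_def, ← AlternatingMap.map_perm, oddPart_ιMulti]
      simp [Function.comp_def, hvw]
    rw [e, smul_mul_assoc, ← evenPart_mul_comm] at h
    have h' := (degreeLT S.p₀ S.p₁ (n + m)).smul_of_tower_mem (Equiv.Perm.sign σ : ℤ) h
    rw [← Units.smul_def, smul_sub, smul_smul, Int.units_mul_self, one_smul] at h'
    exact h'
  rw [Γ_tmul, ExteriorAlgebra.map_apply_ιMulti, twist_β_ιMulti]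
  have e : evenPart p * oddPart (ExteriorAlgebra.ιMulti ℂ m w) = ((m.factorial : ℂ)⁻¹) •
      ∑ _σ : Equiv.Perm (Fin m), (evenPart p * oddPart (ExteriorAlgebra.ιMulti ℂ m w) : S.Sp) := by
    rw [Finset.sum_const, Finset.card_univ, Fintype.card_perm, Fintype.card_fin,
      ← Nat.cast_smul_eq_nsmul ℂ, smul_smul,
      inv_mul_cancel₀ (Nat.cast_ne_zero.2 m.factorial_ne_zero), one_smul]
  rw [e, LinearMap.smul_apply, ← smul_sub, LinearMap.sum_apply, ← Finset.sum_sub_distrib]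
  exact Submodule.smul_mem _ _ (Submodule.sum_mem _ fun σ _ => key σ)

/-- `Γ_z` is bijective if `(ad z)²` is injective on `𝔭₁`. -/
theorem Γ_bijective [FiniteDimensional ℂ 𝔤₁] (z : S.p₀)
    (hz : Function.Injective (S.adp₀k₁ z ∘ₗ S.adp₀p₁ z)) : Function.Bijective (S.Γ z) := by
  -- `φ w = [[z, w], z] = -(ad z)² w`. Precomposing with `φ⁻¹` on the odd factors makes `Γ` the
  -- identity up to lower degree.
  let φ : S.p₁ ≃ₗ[ℂ] S.p₁ :=
    (LinearEquiv.ofInjectiveEndo _ hz).trans (LinearEquiv.neg ℂ)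
  have hφ : ∀ w, S.adk₁p₀ (S.adp₀p₁ z w) z = φ w := fun w => rfl
  let Li : S.Sp →ₗ[ℂ] ExteriorAlgebra ℂ S.p₁ ⊗[ℂ] SymmetricAlgebra ℂ S.p₀ :=
    TensorProduct.map (ExteriorAlgebra.map φ.symm.toLinearMap).toLinearMap LinearMap.id ∘ₗ
      (TensorProduct.comm ℂ _ _).toLinearMap ∘ₗ (equiv S.p₀ S.p₁).toLinearMap
  have hLi : ∀ p q, Li (evenPart p * oddPart q) =
      ExteriorAlgebra.map φ.symm.toLinearMap q ⊗ₜ p := by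
    intro p q
    simp only [Li, ← equiv_symm_tmul, LinearMap.comp_apply, AlgEquiv.toLinearMap_apply,
      AlgEquiv.apply_symm_apply, LinearEquiv.coe_coe, TensorProduct.comm_tmul,
      TensorProduct.map_tmul, LinearMap.id_apply, AlgHom.toLinearMap_apply]
  have hsurj : Function.Surjective Li := by
    refine (TensorProduct.map_surjective ?_ Function.surjective_id).comp
      ((TensorProduct.comm ℂ _ _).surjective.comp (equiv S.p₀ S.p₁).surjective)
    exact ExteriorAlgebra.map_surjective_iff.2 φ.symm.surjective
  have hlow : ∀ n, ∀ a ∈ filtration S.p₀ S.p₁ n,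
      (S.Γ z ∘ₗ Li - 1 : Module.End ℂ S.Sp) a ∈ degreeLT S.p₀ S.p₁ n := by
    intro n a ha
    replace ha := filtration_le_monomialSpan n ha
    suffices h : monomialSpan S.p₀ S.p₁ n ≤
        (degreeLT S.p₀ S.p₁ n).comap (S.Γ z ∘ₗ Li - 1 : Module.End ℂ S.Sp) from h ha
    refine Submodule.span_le.2 ?_
    rintro _ ⟨i, m, p, w, hn, hp, rfl⟩
    refine monotone_nat_of_le_succ degreeLT_le_succ hn ?_
    have e : (S.Γ z ∘ₗ Li - 1 : Module.End ℂ S.Sp)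
        (evenPart p * oddPart (ExteriorAlgebra.ιMulti ℂ m w)) =
        S.Γ z (ExteriorAlgebra.ιMulti ℂ m (φ.symm ∘ w) ⊗ₜ p) -
          evenPart p * oddPart (ExteriorAlgebra.ιMulti ℂ m w) := by
      rw [LinearMap.sub_apply, LinearMap.comp_apply, hLi, Module.End.one_apply,
        ExteriorAlgebra.map_apply_ιMulti]
      rfl
    rw [e]
    exact S.Γ_sub_mem_degreeLT z hp _ _ fun j => by simp [hφ]
  have hbij : Function.Bijective (S.Γ z ∘ₗ Li : Module.End ℂ S.Sp) := by
    refine LinearMap.bijective_of_locally_nilpotent _ fun a => ?_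
    obtain ⟨n, hn⟩ := exists_mem_filtration a
    suffices h : ∀ n, ∀ a ∈ degreeLT S.p₀ S.p₁ n,
        ((S.Γ z ∘ₗ Li - 1 : Module.End ℂ S.Sp) ^ n) a = 0 from ⟨n + 1, h (n + 1) a hn⟩
    intro n
    induction n with
    | zero => exact fun a ha => by rw [(Submodule.mem_bot _).1 ha, map_zero]
    | succ n ih => exact fun a ha => ih _ (hlow n a ha)
  refine ⟨fun a b hab => ?_, fun a => ?_⟩
  · obtain ⟨a, rfl⟩ := hsurj a
    obtain ⟨b, rfl⟩ := hsurj b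
    exact congrArg Li (hbij.1 hab)
  · obtain ⟨b, hb⟩ := hbij.2 a
    exact ⟨Li b, hb⟩

theorem γ_Γ_tmul {z : S.p₀} (hz : Function.Bijective (S.Γ z)) (q : ExteriorAlgebra ℂ S.p₁)
    (p : SymmetricAlgebra ℂ S.p₀) :
    S.γ z (S.Γ z (q ⊗ₜ p)) = ExteriorAlgebra.algebraMapInv q • p := by
  rw [γ, dif_pos hz, LinearMap.comp_apply, LinearEquiv.coe_coe]
  have : (LinearEquiv.ofBijective (S.Γ z) hz).symm (S.Γ z (q ⊗ₜ p)) = q ⊗ₜ p :=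
    (LinearEquiv.ofBijective (S.Γ z) hz).symm_apply_apply (q ⊗ₜ p)
  rw [this]
  simp [augment]

/-- `β(1) = 1`, so `Γ` sends `1 ⊗ p` to `p`. -/
theorem γ_evenPart {z : S.p₀} (hz : Function.Bijective (S.Γ z)) (p : SymmetricAlgebra ℂ S.p₀) :
    S.γ z (evenPart p) = p := by
  have h1 := S.twist_β_ιMulti z ![]
  rw [ExteriorAlgebra.ιMulti_zero_apply] at h1
  have := S.γ_Γ_tmul hz 1 p
  rw [Γ_tmul, map_one, h1] at this
  simpa using this

end SymmetricSuperpair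

/-! ### Reordering words of odd operators. -/

namespace SymmetricSuperpair

open LieSuperalgebra SuperSym

variable {𝔤₀ 𝔤₁ : Type*} [LieRing 𝔤₀] [LieAlgebra ℂ 𝔤₀] [AddCommGroup 𝔤₁]
    [Module ℂ 𝔤₁] [LieRingModule 𝔤₀ 𝔤₁] [LieModule ℂ 𝔤₀ 𝔤₁] [LieSuperalgebra 𝔤₀ 𝔤₁]
    (S : SymmetricSuperpair 𝔤₀ 𝔤₁)

section words

variable (z : S.p₀) (K : Set S.k₁) (N : Submodule ℂ S.Sp)

/-- The span of the elements `u_z(u₁) ⋯ u_z(uₙ) p` with `uᵢ ∈ K` and `p ∈ N`. -/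
def wordSpan (n : ℕ) : Submodule ℂ S.Sp :=
  Submodule.span ℂ {a | ∃ u : Fin n → S.k₁, (∀ i, u i ∈ K) ∧ ∃ p ∈ N,
    a = (List.ofFn fun i => S.tw₁ z (u i)).prod p}

/-- The words of length `n - 2`, where words of length zero are disregarded. -/
def lowerWordSpan : ℕ → Submodule ℂ S.Sp
  | n + 3 => S.wordSpan z K N (n + 1)
  | _ => ⊥

variable {S z K N}

theorem prod_mem_wordSpan {n : ℕ} {u : Fin n → S.k₁} (hu : ∀ i, u i ∈ K) {p : S.Sp} (hp : p ∈ N) :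
    (List.ofFn fun i => S.tw₁ z (u i)).prod p ∈ S.wordSpan z K N n :=
  Submodule.subset_span ⟨u, hu, p, hp, rfl⟩

theorem mem_wordSpan_zero {p : S.Sp} (hp : p ∈ N) : p ∈ S.wordSpan z K N 0 := by
  simpa using prod_mem_wordSpan (z := z) (K := K) (u := ![]) (by simp) hp

theorem wordSpan_zero_le : S.wordSpan z K N 0 ≤ N := by
  refine Submodule.span_le.2 ?_
  rintro _ ⟨u, -, p, hp, rfl⟩
  simpa using hp

theorem tw₁_mem_wordSpan {n : ℕ} {u : S.k₁} (hu : u ∈ K) {a : S.Sp}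
    (ha : a ∈ S.wordSpan z K N n) : S.tw₁ z u a ∈ S.wordSpan z K N (n + 1) := by
  suffices h : S.wordSpan z K N n ≤ (S.wordSpan z K N (n + 1)).comap (S.tw₁ z u) from h ha
  refine Submodule.span_le.2 ?_
  rintro _ ⟨v, hv, p, hp, rfl⟩
  have := prod_mem_wordSpan (z := z) (u := Fin.cons (α := fun _ => S.k₁) u v)
    (Fin.cases hu hv) hp
  simpa using this

theorem wordSpan_succ_le {n : ℕ} {G : Submodule ℂ S.Sp}
    (hG : ∀ u ∈ K, ∀ a ∈ S.wordSpan z K N n, S.tw₁ z u a ∈ G) : S.wordSpan z K N (n + 1) ≤ G := by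
  refine Submodule.span_le.2 ?_
  rintro _ ⟨v, hv, p, hp, rfl⟩
  rw [List.ofFn_succ, List.prod_cons, Module.End.mul_apply]
  exact hG _ (hv 0) _ (prod_mem_wordSpan (fun i => hv i.succ) hp)

theorem tw₁_mem_lowerWordSpan {n : ℕ} {u : S.k₁} (hu : u ∈ K) {a : S.Sp}
    (ha : a ∈ S.lowerWordSpan z K N n) : S.tw₁ z u a ∈ S.lowerWordSpan z K N (n + 1) := by
  match n with
  | 0 | 1 | 2 => rw [(Submodule.mem_bot _).1 ha, map_zero]; exact zero_mem _
  | n + 3 => exact tw₁_mem_wordSpan hu ha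

/-- The even operator is commuted to the right, where it kills `N`; each commutator only replaces
one letter by another in `K`. The index `n + 2` counts the two letters whose bracket is `x` in the
application, so the empty word yields zero. -/
theorem tw₀_mem_lowerWordSpan {x : S.k₀} (hN : ∀ p ∈ N, S.tw₀ z x p = 0)
    (hK : ∀ u ∈ K, S.lie₀₁ x u ∈ K) {n : ℕ} {a : S.Sp} (ha : a ∈ S.wordSpan z K N n) :
    S.tw₀ z x a ∈ S.lowerWordSpan z K N (n + 2) := by
  induction n generalizing a with
  | zero => rw [hN a (wordSpan_zero_le ha)]; exact zero_mem _
  | succ n ih =>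
    suffices h : S.wordSpan z K N (n + 1) ≤
      (S.lowerWordSpan z K N (n + 3)).comap (S.tw₀ z x) from h ha
    refine wordSpan_succ_le fun u hu a ha => ?_
    have h := LinearMap.congr_fun (S.tw₀₁ z x u) a
    rw [Module.End.mul_apply] at h
    rw [Submodule.mem_comap, h]
    exact add_mem (tw₁_mem_lowerWordSpan hu (ih ha)) (tw₁_mem_wordSpan (hK u hu) ha)

/-- Swapping two adjacent odd letters costs the even operator of their bracket, acting on the word
to their right. Later positions reduce to the first by peeling off leading letters. -/
theorem prod_swap_add_mem_lowerWordSpan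
    (hN : ∀ u ∈ K, ∀ v ∈ K, ∀ p ∈ N, S.tw₀ z (S.lie₁₁ u v) p = 0)
    (hK : ∀ u ∈ K, ∀ v ∈ K, ∀ w ∈ K, S.lie₀₁ (S.lie₁₁ u v) w ∈ K)
    {n : ℕ} (i : Fin (n + 1)) {u : Fin (n + 2) → S.k₁} (hu : ∀ j, u j ∈ K) {p : S.Sp} (hp : p ∈ N) :
    (List.ofFn fun j => S.tw₁ z (u (Equiv.swap i.castSucc i.succ j))).prod p +
      (List.ofFn fun j => S.tw₁ z (u j)).prod p ∈ S.lowerWordSpan z K N (n + 2) := by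
  induction i using Fin.cases with
  | zero =>
    have h0 : Equiv.swap (Fin.castSucc (0 : Fin (n + 1))) (Fin.succ 0) 0 = Fin.succ 0 := by simp
    have h1 : Equiv.swap (Fin.castSucc (0 : Fin (n + 1))) (Fin.succ 0) (Fin.succ 0) = 0 := by simp
    have h2 : ∀ j : Fin n, Equiv.swap (Fin.castSucc (0 : Fin (n + 1))) (Fin.succ 0) j.succ.succ
        = j.succ.succ := fun j => by
      refine Equiv.swap_apply_of_ne_of_ne ?_ ?_ <;> simp [Fin.ext_iff]
    simp only [List.ofFn_succ, h0, h1, h2, List.prod_cons]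
    have h := LinearMap.congr_fun (S.tw₁₁ z (u (Fin.succ 0)) (u 0))
      ((List.ofFn fun j : Fin n => S.tw₁ z (u j.succ.succ)).prod p)
    rw [LinearMap.add_apply, LinearMap.neg_apply, Module.End.mul_apply, Module.End.mul_apply] at h
    simp only [Module.End.mul_apply]
    rw [h, neg_add_eq_sub, sub_add_cancel]
    exact tw₀_mem_lowerWordSpan (fun p hp => hN _ (hu _) _ (hu _) p hp)
      (fun w hw => hK _ (hu _) _ (hu _) w hw) (prod_mem_wordSpan (fun j => hu _) hp)
  | succ i =>
    cases n with
    | zero => exact i.elim0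
    | succ n =>
      have h0 : Equiv.swap (Fin.castSucc i.succ) i.succ.succ 0 = 0 :=
        Equiv.swap_apply_of_ne_of_ne (Fin.succ_ne_zero i.castSucc).symm (Fin.succ_ne_zero i.succ).symm
      have h1 : ∀ j : Fin (n + 2), Equiv.swap (Fin.castSucc i.succ) i.succ.succ j.succ
          = (Equiv.swap i.castSucc i.succ j).succ := fun j =>
        (Fin.succ_injective _).swap_apply i.castSucc i.succ j
      rw [List.ofFn_succ, List.ofFn_succ (f := fun j => S.tw₁ z (u j))]
      simp only [h0, h1, List.prod_cons, Module.End.mul_apply]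
      rw [← map_add]
      exact tw₁_mem_lowerWordSpan (hu 0)
        (prod_swap_add_mem_lowerWordSpan hN hK i (u := fun j => u j.succ) (fun j => hu _) hp)

theorem sign_smul_prod_sub_mem_lowerWordSpan
    (hN : ∀ u ∈ K, ∀ v ∈ K, ∀ p ∈ N, S.tw₀ z (S.lie₁₁ u v) p = 0)
    (hK : ∀ u ∈ K, ∀ v ∈ K, ∀ w ∈ K, S.lie₀₁ (S.lie₁₁ u v) w ∈ K)
    {n : ℕ} (σ : Equiv.Perm (Fin n)) {u : Fin n → S.k₁} (hu : ∀ j, u j ∈ K) {p : S.Sp}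
    (hp : p ∈ N) :
    Equiv.Perm.sign σ • (List.ofFn fun j => S.tw₁ z (u (σ j))).prod p -
      (List.ofFn fun j => S.tw₁ z (u j)).prod p ∈ S.lowerWordSpan z K N n := by
  match n with
  | 0 | 1 =>
    rw [Subsingleton.elim σ 1]
    simp
  | n + 2 =>
    -- Adjacent transpositions generate the symmetric group; errors of composed permutations add up
    -- by telescoping.
    have hσ : σ ∈ Submonoid.closure
        (Set.range fun i : Fin (n + 1) => Equiv.swap i.castSucc i.succ) := by
      rw [Equiv.Perm.mclosure_swap_castSucc_succ]; trivial
    induction hσ using Submonoid.closure_induction generalizing u with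
    | mem σ hσ =>
      obtain ⟨i, rfl⟩ := hσ
      have := neg_mem (prod_swap_add_mem_lowerWordSpan hN hK i hu hp)
      rw [Equiv.Perm.sign_swap (Fin.castSucc_lt_succ (i := i)).ne, Units.neg_smul, one_smul,
        ← neg_add']
      exact this
    | one => simp
    | mul σ τ _ _ hσ hτ =>
      have h := (S.lowerWordSpan z K N (n + 2)).smul_of_tower_mem (Equiv.Perm.sign σ : ℤ)
        (hτ (fun j => u (σ j)) fun j => hu _)
      have := add_mem h (hσ u hu)
      rw [← Units.smul_def, smul_sub, smul_smul, sub_add_sub_cancel] at this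
      rwa [Equiv.Perm.sign_mul]

/-- The radial part kills all words of positive length. -/
theorem γ_eq_zero_of_mem_wordSpan (hz : Function.Bijective (S.Γ z))
    (hN : ∀ u ∈ K, ∀ v ∈ K, ∀ p ∈ N, S.tw₀ z (S.lie₁₁ u v) p = 0)
    (hK : ∀ u ∈ K, ∀ v ∈ K, ∀ w ∈ K, S.lie₀₁ (S.lie₁₁ u v) w ∈ K)
    (hKz : ∀ u ∈ K, ∃ w, S.adp₀p₁ z w = u) (hNe : ∀ p ∈ N, ∃ p', evenPart p' = p)
    {n : ℕ} {a : S.Sp} (ha : a ∈ S.wordSpan z K N (n + 1)) : S.γ z a = 0 := by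
  induction n using Nat.strong_induction_on generalizing a with
  | _ n ih =>
    have hlow : ∀ a ∈ S.lowerWordSpan z K N (n + 1), S.γ z a = 0 := by
      intro a ha
      match n with
      | 0 | 1 => rw [(Submodule.mem_bot _).1 ha, map_zero]
      | n + 2 => exact ih n (by omega) ha
    suffices h : S.wordSpan z K N (n + 1) ≤ LinearMap.ker (S.γ z) from h ha
    refine Submodule.span_le.2 ?_
    rintro _ ⟨u, hu, p, hp, rfl⟩
    choose w hw using fun i => hKz (u i) (hu i)
    obtain ⟨p', rfl⟩ := hNe p hp
    -- The augmentation kills a product of at least one odd vector, so `γ` kills the antisymmetrised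
    -- word.
    have h1 := S.γ_Γ_tmul hz (ExteriorAlgebra.ιMulti ℂ (n + 1) w) p'
    rw [Γ_tmul, ExteriorAlgebra.map_apply_ιMulti, twist_β_ιMulti, ExteriorAlgebra.ιMulti_succ_apply,
      map_mul] at h1
    simp only [ExteriorAlgebra.algebraMapInv, ExteriorAlgebra.lift_ι_apply, LinearMap.zero_apply,
      zero_mul, zero_smul, Function.comp_apply, hw] at h1
    rw [LinearMap.smul_apply, map_smul, smul_eq_zero, LinearMap.sum_apply, map_sum] at h1
    have h2 := h1.resolve_left (inv_ne_zero (Nat.cast_ne_zero.2 (Nat.factorial_ne_zero _)))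
    -- Modulo shorter nonempty words, killed by induction, all `(n + 1)!` signed reorderings agree,
    -- so their vanishing sum is a nonzero multiple of one word.
    have h3 : ∀ σ : Equiv.Perm (Fin (n + 1)),
        S.γ z ((Equiv.Perm.sign σ • (List.ofFn fun j => S.tw₁ z (u (σ j))).prod) (evenPart p'))
          = S.γ z ((List.ofFn fun j => S.tw₁ z (u j)).prod (evenPart p')) := fun σ => by
      rw [← sub_eq_zero, ← map_sub]
      exact hlow _ (sign_smul_prod_sub_mem_lowerWordSpan hN hK σ hu hp)
    rw [Finset.sum_congr rfl fun σ _ => h3 σ, Finset.sum_const, Finset.card_univ, Fintype.card_perm,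
      Fintype.card_fin, ← Nat.cast_smul_eq_nsmul ℂ, smul_eq_zero] at h2
    exact h2.resolve_left (Nat.cast_ne_zero.2 (Nat.factorial_ne_zero _))

end words

end SymmetricSuperpair

/-! ### The differential recursion of the Bessel polynomials. -/

noncomputable section

namespace Polynomial

/-- The Bessel polynomials `∑ⱼ (k + j)! / (2ʲ (k - j)! j!) (-s)ʲ X^(k - j)`. -/
def bessel (s : ℂ) (k : ℕ) : ℂ[X] :=
  ∑ j ∈ Finset.range (k + 1),
    C (((k + j).factorial : ℂ) / (2 ^ j * (k - j).factorial * j.factorial) * (-s) ^ j) * X ^ (k - j)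

theorem bessel_zero (s : ℂ) : bessel s 0 = 1 := by
  simp [bessel]

/-- Compare coefficients: the derivative of term `j` has the same power of `X` as term `j + 1` of
the undifferentiated sum. -/
theorem bessel_succ_add_derivative (s : ℂ) (k : ℕ) :
    bessel s (k + 1) + C s * derivative (bessel s (k + 1)) = X * bessel s k := by
  have h1 : C s * derivative (bessel s (k + 1)) = ∑ j ∈ Finset.range (k + 1),
      C (-((((k + 1 + j).factorial : ℂ) / (2 ^ j * (k + 1 - j).factorial * j.factorial) *
        ((k + 1 - j : ℕ) : ℂ))) * (-s) ^ (j + 1)) * X ^ (k - j) := by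
    rw [bessel, derivative_sum, Finset.mul_sum, Finset.sum_range_succ]
    simp only [derivative_C_mul, derivative_X_pow, Nat.sub_self, Nat.cast_zero, map_zero, zero_mul,
      mul_zero, add_zero]
    refine Finset.sum_congr rfl fun j hj => ?_
    have : k + 1 - j - 1 = k - j := by omega
    rw [this, ← mul_assoc, ← mul_assoc, ← map_mul, ← map_mul]
    congr 2
    ring
  rw [h1, bessel, Finset.sum_range_succ', add_right_comm, ← Finset.sum_add_distrib,
    Finset.sum_range_succ, bessel, Finset.sum_range_succ', mul_add, Finset.mul_sum]
  -- The constant terms cancel, since `(2k + 2)! / (2 (k + 1)) = (2k + 1)!`.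
  have h2 : C (((k + 1 + (k + 1)).factorial : ℂ) /
        (2 ^ (k + 1) * (k + 1 - (k + 1)).factorial * (k + 1).factorial) * (-s) ^ (k + 1)) *
      X ^ (k + 1 - (k + 1)) +
      C (-((((k + 1 + k).factorial : ℂ) / (2 ^ k * (k + 1 - k).factorial * k.factorial) *
        ((k + 1 - k : ℕ) : ℂ))) * (-s) ^ (k + 1)) * X ^ (k - k) = 0 := by
    have e1 : k + 1 + (k + 1) = (2 * k + 1) + 1 := by ring
    have e2 : k + 1 + k = 2 * k + 1 := by ring
    have e3 : k + 1 - k = 1 := by omega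
    rw [e1, e2, e3, Nat.sub_self, Nat.sub_self, ← add_mul, ← map_add]
    convert zero_mul _
    convert map_zero (C : ℂ →+* ℂ[X])
    rw [Nat.factorial_succ (2 * k + 1), Nat.factorial_succ k]
    have := Nat.cast_ne_zero (R := ℂ).2 (Nat.factorial_ne_zero k)
    have h : (k : ℂ) + 1 ≠ 0 := Nat.cast_add_one_ne_zero k
    push_cast [Nat.factorial]
    field_simp
    ring
  rw [h2, add_zero]
  congr 1
  · refine Finset.sum_congr rfl fun j hj => ?_
    -- With `r` the distance to the top index, the claim becomes `(2j + r + 3) - 2(j + 1) = r + 1`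
    -- after clearing common factors.
    obtain ⟨r, rfl⟩ := Nat.exists_eq_add_of_lt (Finset.mem_range.1 hj)
    have e1 : j + r + 1 + 1 - (j + 1) = r + 1 := by omega
    have e2 : j + r + 1 - j = r + 1 := by omega
    have e3 : j + r + 1 + 1 - j = r + 2 := by omega
    have e4 : j + r + 1 - (j + 1) = r := by omega
    have e5 : j + r + 1 + 1 + (j + 1) = 2 * j + r + 2 + 1 := by ring
    have e6 : j + r + 1 + 1 + j = 2 * j + r + 2 := by ring
    have e7 : j + r + 1 + (j + 1) = 2 * j + r + 2 := by ring
    rw [e1, e2, e3, e4, e5, e6, e7, ← add_mul, ← map_add, mul_left_comm, ← pow_succ']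
    congr 2
    rw [Nat.factorial_succ (2 * j + r + 2), Nat.factorial_succ j, Nat.factorial_succ (r + 1),
      Nat.factorial_succ r]
    have h1 := Nat.cast_ne_zero (R := ℂ).2 (Nat.factorial_ne_zero j)
    have h2 := Nat.cast_ne_zero (R := ℂ).2 (Nat.factorial_ne_zero r)
    have h3 : (j : ℂ) + 1 ≠ 0 := Nat.cast_add_one_ne_zero j
    have h4 : (r : ℂ) + 1 ≠ 0 := Nat.cast_add_one_ne_zero r
    have h5 : (r : ℂ) + 1 + 1 ≠ 0 := by exact_mod_cast Nat.succ_ne_zero (r + 1)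
    push_cast
    field_simp
    ring
  · have h1 := Nat.cast_ne_zero (R := ℂ).2 (Nat.factorial_ne_zero k)
    have h2 := Nat.cast_ne_zero (R := ℂ).2 (Nat.factorial_ne_zero (k + 1))
    simp only [Nat.sub_zero, add_zero, pow_zero, Nat.factorial_zero, Nat.cast_one, mul_one, one_mul]
    rw [div_self h1, div_self h2, map_one, one_mul, one_mul, ← pow_succ']

end Polynomial

/-! ### Brackets of the components of odd root vectors. -/

namespace SymmetricSuperpair

open LieSuperalgebra SuperSym

variable {𝔤₀ 𝔤₁ : Type*} [LieRing 𝔤₀] [LieAlgebra ℂ 𝔤₀] [AddCommGroup 𝔤₁]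
    [Module ℂ 𝔤₁] [LieRingModule 𝔤₀ 𝔤₁] [LieModule ℂ 𝔤₀ 𝔤₁] [LieSuperalgebra 𝔤₀ 𝔤₁]
    (S : SymmetricSuperpair 𝔤₀ 𝔤₁)

/-- The pairs `(y, z) ∈ 𝔨₁ × 𝔭₁` with `y + z ∈ 𝔤₁^l`. -/
def rootPairs (𝔞 : Submodule ℂ 𝔤₀) (l : Module.Dual ℂ 𝔞) : Submodule ℂ (S.k₁ × S.p₁) :=
  (weightSpace 𝔞 𝔤₁ l).comap (S.k₁.subtype.coprod S.p₁.subtype)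

variable {S} {𝔞 : Submodule ℂ 𝔤₀} {l : Module.Dual ℂ 𝔞}

theorem mem_rootPairs {q : S.k₁ × S.p₁} :
    q ∈ S.rootPairs 𝔞 l ↔ ∀ h : 𝔞, ⁅(h : 𝔤₀), (q.1 : 𝔤₁) + q.2⁆ = l h • ((q.1 : 𝔤₁) + q.2) :=
  Iff.rfl

theorem eq_and_eq_of_add_eq_add_of_sub_eq_sub {M : Type*} [AddCommGroup M] [Module ℂ M]
    {a b c d : M} (h1 : a + b = c + d) (h2 : a - b = c - d) : a = c ∧ b = d := by
  have h : a = c := by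
    have : (2 : ℂ) • a = (2 : ℂ) • c := by
      rw [two_smul, two_smul, ← add_add_sub_cancel a a b, h1, h2, add_add_sub_cancel]
    exact (smul_right_injective M (two_ne_zero (α := ℂ))) this
  exact ⟨h, by rwa [h, add_right_inj] at h1⟩

/-- Applying `θ` gives `[h, y - z] = -l(h)(y - z)`; compare with `[h, y + z] = l(h)(y + z)`. -/
theorem IsEvenCartan.lie_rootPairs (h𝔞 : S.IsEvenCartan 𝔞) {q : S.k₁ × S.p₁}
    (hq : q ∈ S.rootPairs 𝔞 l) (h : 𝔞) :
    ⁅(h : 𝔤₀), (q.1 : 𝔤₁)⁆ = l h • (q.2 : 𝔤₁) ∧ ⁅(h : 𝔤₀), (q.2 : 𝔤₁)⁆ = l h • (q.1 : 𝔤₁) := by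
  have h1 := mem_rootPairs.1 hq h
  have h2 := congrArg S.θ₁ h1
  rw [S.θ₁_lie, map_smul, map_add, S.θ₁_k, S.θ₁_p, show S.θ₀ h = -h from h𝔞.le h.2, neg_lie,
    ← sub_eq_add_neg, lie_sub, neg_sub, smul_sub] at h2
  rw [lie_add, smul_add, add_comm (l h • (q.1 : 𝔤₁))] at h1
  refine eq_and_eq_of_add_eq_add_of_sub_eq_sub h1 ?_
  rw [← neg_sub, h2, neg_sub]

/-- The bracket of two vectors of `𝔤₁^l` lies in `𝔤₀^{2l} = 0`; the two equations are its `𝔨₀`- and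
`𝔭₀`-components. -/
theorem oddBracket_rootPairs
    (hl : l ∈ barRestrictedRoots₁ 𝔤₁ 𝔞) {q q' : S.k₁ × S.p₁}
    (hq : q ∈ S.rootPairs 𝔞 l) (hq' : q' ∈ S.rootPairs 𝔞 l) :
    oddBracket (q.1 : 𝔤₁) (q'.1 : 𝔤₁) + oddBracket (q.2 : 𝔤₁) (q'.2 : 𝔤₁) = (0 : 𝔤₀) ∧
    oddBracket (q.1 : 𝔤₁) (q'.2 : 𝔤₁) + oddBracket (q.2 : 𝔤₁) (q'.1 : 𝔤₁) = (0 : 𝔤₀) := by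
  have h0 : oddBracket ((q.1 : 𝔤₁) + q.2) ((q'.1 : 𝔤₁) + q'.2) = (0 : 𝔤₀) := by
    have hbot : weightSpace 𝔞 𝔤₀ ((2 : ℂ) • l) = ⊥ := by
      by_contra hne
      exact hl.2.2 ⟨smul_ne_zero two_ne_zero hl.1.1, hne⟩
    rw [← Submodule.mem_bot ℂ, ← hbot]
    intro h
    rw [lie_oddBracket, mem_rootPairs.1 hq, mem_rootPairs.1 hq', map_smul, map_smul,
      LinearMap.smul_apply, ← add_smul, LinearMap.smul_apply, two_smul]
  have h1 := congrArg S.θ₀ h0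
  rw [S.θ₀_oddBracket] at h1
  simp only [map_add, S.θ₁_k, S.θ₁_p, map_neg, map_zero, LinearMap.add_apply,
    LinearMap.neg_apply] at h0 h1
  refine eq_and_eq_of_add_eq_add_of_sub_eq_sub ?_ ?_
  · rw [add_zero, ← h0]; abel
  · rw [sub_zero, ← h1]; abel

theorem IsEvenCartan.lie_oddBracket_k (h𝔞 : S.IsEvenCartan 𝔞)
    (hl : l ∈ barRestrictedRoots₁ 𝔤₁ 𝔞) {q q' : S.k₁ × S.p₁}
    (hq : q ∈ S.rootPairs 𝔞 l) (hq' : q' ∈ S.rootPairs 𝔞 l) (h : 𝔞) :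
    ⁅(h : 𝔤₀), oddBracket (q.1 : 𝔤₁) (q'.1 : 𝔤₁)⁆ = (0 : 𝔤₀) := by
  rw [lie_oddBracket, (h𝔞.lie_rootPairs hq h).1, (h𝔞.lie_rootPairs hq' h).1, map_smul, map_smul,
    LinearMap.smul_apply, ← smul_add, add_comm, (oddBracket_rootPairs hl hq hq').2, smul_zero]

/-- The bracket lies in `𝔭₀` and commutes with `𝔞`, hence lies in `𝔞`; there it is determined by its
pairing with `𝔞`, which invariance computes. -/
theorem IsEvenCartan.oddBracket_k_p [FiniteDimensional ℂ 𝔤₀] (h𝔞 : S.IsEvenCartan 𝔞)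
    (hl : l ∈ barRestrictedRoots₁ 𝔤₁ 𝔞) {q q' : S.k₁ × S.p₁}
    (hq : q ∈ S.rootPairs 𝔞 l) (hq' : q' ∈ S.rootPairs 𝔞 l) :
    S.adk₁p₁ q.1 q'.2 = -S.b₁ q.1 q'.1 • Submodule.inclusion h𝔞.le (S.A 𝔞 l) := by
  have hmem : oddBracket (q.1 : 𝔤₁) (q'.2 : 𝔤₁) ∈ 𝔞 := by
    refine (h𝔞.centralizer₀ _ (S.adk₁p₁ q.1 q'.2).2).1 fun h hh => ?_
    change ⁅h, oddBracket (q.1 : 𝔤₁) (q'.2 : 𝔤₁)⁆ = (0 : 𝔤₀)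
    rw [lie_oddBracket, (h𝔞.lie_rootPairs hq ⟨h, hh⟩).1, (h𝔞.lie_rootPairs hq' ⟨h, hh⟩).2, map_smul,
      map_smul, LinearMap.smul_apply, ← smul_add, add_comm, (oddBracket_rootPairs hl hq hq').1,
      smul_zero]
  refine Subtype.ext (sub_eq_zero.1 (h𝔞.eq_zero_of_b₀ (sub_mem hmem
    (𝔞.smul_mem (-S.b₁ q.1 q'.1) (S.A 𝔞 l).2)) fun h hh => ?_))
  change S.b₀ (oddBracket (q.1 : 𝔤₁) (q'.2 : 𝔤₁) - -S.b₁ q.1 q'.1 • (S.A 𝔞 l : 𝔤₀)) h = 0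
  rw [map_sub, LinearMap.sub_apply, S.b_invariant₁₁₀, (h𝔞.lie_rootPairs hq' ⟨h, hh⟩).2, map_smul,
    LinearMap.smul_apply, h𝔞.b₀_A l ⟨h, hh⟩, map_neg, map_smul, smul_eq_mul, smul_eq_mul]
  ring

/-- The bracket of two letters commutes with `𝔞` and so preserves weights. This is the closure
condition needed to reorder words. -/
theorem IsEvenCartan.lie_lie₁₁_mem_rootPairs (h𝔞 : S.IsEvenCartan 𝔞)
    (hl : l ∈ barRestrictedRoots₁ 𝔤₁ 𝔞) {q q' r : S.k₁ × S.p₁}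
    (hq : q ∈ S.rootPairs 𝔞 l) (hq' : q' ∈ S.rootPairs 𝔞 l) (hr : r ∈ S.rootPairs 𝔞 l) :
    (S.lie₀₁ (S.lie₁₁ q.1 q'.1) r.1, S.adk₀p₁ (S.lie₁₁ q.1 q'.1) r.2) ∈ S.rootPairs 𝔞 l := by
  refine mem_rootPairs.2 fun h => ?_
  change ⁅(h : 𝔤₀), ⁅(oddBracket (q.1 : 𝔤₁) (q'.1 : 𝔤₁) : 𝔤₀), (r.1 : 𝔤₁)⁆ +
    ⁅(oddBracket (q.1 : 𝔤₁) (q'.1 : 𝔤₁) : 𝔤₀), (r.2 : 𝔤₁)⁆⁆ =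
    l h • (⁅(oddBracket (q.1 : 𝔤₁) (q'.1 : 𝔤₁) : 𝔤₀), (r.1 : 𝔤₁)⁆ +
    ⁅(oddBracket (q.1 : 𝔤₁) (q'.1 : 𝔤₁) : 𝔤₀), (r.2 : 𝔤₁)⁆)
  rw [← lie_add, leibniz_lie, h𝔞.lie_oddBracket_k hl hq hq', zero_lie, zero_add,
    mem_rootPairs.1 hr, lie_smul]

theorem IsEvenCartan.adk₁p₀_rootPairs (h𝔞 : S.IsEvenCartan 𝔞) {q : S.k₁ × S.p₁}
    (hq : q ∈ S.rootPairs 𝔞 l) (h : 𝔞) :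
    S.adk₁p₀ q.1 (Submodule.inclusion h𝔞.le h) = -l h • q.2 :=
  Subtype.ext ((congrArg Neg.neg (h𝔞.lie_rootPairs hq h).1).trans (neg_smul _ _).symm)

theorem IsEvenCartan.adk₀p₀_lie₁₁ (h𝔞 : S.IsEvenCartan 𝔞)
    (hl : l ∈ barRestrictedRoots₁ 𝔤₁ 𝔞) {q q' : S.k₁ × S.p₁}
    (hq : q ∈ S.rootPairs 𝔞 l) (hq' : q' ∈ S.rootPairs 𝔞 l) (h : 𝔞) :
    S.adk₀p₀ (S.lie₁₁ q.1 q'.1) (Submodule.inclusion h𝔞.le h) = 0 := by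
  refine Subtype.ext ((lie_skew _ _).symm.trans ?_)
  rw [ZeroMemClass.coe_zero, neg_eq_zero]
  exact h𝔞.lie_oddBracket_k hl hq hq' h

/-- A root does not vanish on oddly regular elements. -/
theorem IsEvenCartan.apply_ne_zero (h𝔞 : S.IsEvenCartan 𝔞) {h : 𝔞}
    (hh : S.IsOddlyRegular (Submodule.inclusion h𝔞.le h)) {q : S.k₁ × S.p₁}
    (hq : q ∈ S.rootPairs 𝔞 l) (hq0 : q.1 ≠ 0) (hl0 : l ≠ 0) : l h ≠ 0 := by
  intro h0
  -- If `l h = 0`, then `h` annihilates the `𝔭₁`-component, which must vanish; every `[h', q.2] =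
  -- l(h') q.1` is then zero.
  have h2 : q.2 = 0 := by
    refine hh.adp₀p₁_injective ?_
    rw [map_zero]
    refine Subtype.ext ((h𝔞.lie_rootPairs hq h).2.trans ?_)
    rw [h0, zero_smul]; rfl
  refine hl0 (LinearMap.ext fun h' => ?_)
  have h3 := (h𝔞.lie_rootPairs hq h').2
  rw [h2, ZeroMemClass.coe_zero, lie_zero, eq_comm, smul_eq_zero] at h3
  exact h3.resolve_right fun h4 => hq0 (Subtype.ext h4)

end SymmetricSuperpair

end

/-! ### Words over polynomials in `A_l`. -/

noncomputable section

namespace SymmetricSuperpair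

open LieSuperalgebra SuperSym Polynomial

variable {𝔤₀ 𝔤₁ : Type*} [LieRing 𝔤₀] [LieAlgebra ℂ 𝔤₀] [AddCommGroup 𝔤₁]
    [Module ℂ 𝔤₁] [LieRingModule 𝔤₀ 𝔤₁] [LieModule ℂ 𝔤₀ 𝔤₁] [LieSuperalgebra 𝔤₀ 𝔤₁]
    {S : SymmetricSuperpair 𝔤₀ 𝔤₁} {𝔞 : Submodule ℂ 𝔤₀} {l : Module.Dual ℂ 𝔞}

/-- The vector `A_l`, as an element of `S(𝔭)`. -/
def IsEvenCartan.evenA (h𝔞 : S.IsEvenCartan 𝔞) (l : Module.Dual ℂ 𝔞) : S.Sp :=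
  even (Submodule.inclusion h𝔞.le (S.A 𝔞 l))

/-- The span of the words in the operators `u_h(y)`, `y ∈ 𝔨₁^l`, applied to polynomials
in `A_l`. -/
def IsEvenCartan.rootWordSpan (h𝔞 : S.IsEvenCartan 𝔞) (l : Module.Dual ℂ 𝔞) (h : 𝔞) (n : ℕ) :
    Submodule ℂ S.Sp :=
  S.wordSpan (Submodule.inclusion h𝔞.le h) (Prod.fst '' (S.rootPairs 𝔞 l : Set (S.k₁ × S.p₁)))
    (LinearMap.range (aeval (R := ℂ) (h𝔞.evenA l)).toLinearMap) n

section

variable (h𝔞 : S.IsEvenCartan 𝔞) {q q' : S.k₁ × S.p₁}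

theorem IsEvenCartan.evenPart_aeval (P : ℂ[X]) :
    evenPart (aeval (SymmetricAlgebra.ι ℂ S.p₀ (Submodule.inclusion h𝔞.le (S.A 𝔞 l))) P) =
      aeval (h𝔞.evenA l) P := by
  rw [← aeval_algHom_apply]; rfl

theorem IsEvenCartan.tw₁_evenA (hq : q ∈ S.rootPairs 𝔞 l) (h : 𝔞) (d : S.Sp) :
    S.tw₁ (Submodule.inclusion h𝔞.le h) q.1 (h𝔞.evenA l * d) =
      -l (S.A 𝔞 l) • (odd q.2 * d) +
        h𝔞.evenA l * S.tw₁ (Submodule.inclusion h𝔞.le h) q.1 d := by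
  rw [evenA, tw₁_even, h𝔞.adk₁p₀_rootPairs hq, map_smul, smul_mul_assoc]

/-- The multiplication part contributes `[y, h] = -l(h) z`; the derivation part contributes `[y,
A_l] = -l(A_l) z` times the derivative of `P`. -/
theorem IsEvenCartan.tw₁_aeval (hq : q ∈ S.rootPairs 𝔞 l) (h : 𝔞) (P : ℂ[X]) :
    S.tw₁ (Submodule.inclusion h𝔞.le h) q.1 (aeval (h𝔞.evenA l) P) =
      -(l h • (odd q.2 * aeval (h𝔞.evenA l) P)) -
        l (S.A 𝔞 l) • (odd q.2 * aeval (h𝔞.evenA l) (derivative P)) := by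
  induction P using Polynomial.induction_on with
  | C c =>
    rw [aeval_C, derivative_C, map_zero, Algebra.algebraMap_eq_smul_one, map_smul, tw₁_one,
      h𝔞.adk₁p₀_rootPairs hq, mul_zero, smul_zero, sub_zero, mul_smul_comm, mul_one, map_smul,
      neg_smul, smul_neg, smul_comm]
  | add P Q hP hQ =>
    rw [map_add, map_add, hP, hQ, derivative_add, map_add, mul_add, mul_add, smul_add, smul_add]
    abel
  | monomial n c ih =>
    have hX : ∀ R : ℂ[X], aeval (h𝔞.evenA l) (X * R) = h𝔞.evenA l * aeval (h𝔞.evenA l) R := by simp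
    rw [pow_succ', mul_left_comm, derivative_mul, derivative_X, one_mul, map_add, hX, hX,
      h𝔞.tw₁_evenA hq, ih]
    have : ∀ d, h𝔞.evenA l * (odd q.2 * d) = odd q.2 * (h𝔞.evenA l * d) := fun d => by
      rw [← mul_assoc, IsEvenCartan.evenA, even_mul_comm, mul_assoc]
    simp only [mul_sub, mul_add, mul_neg, mul_smul_comm, this, smul_add, neg_smul]
    abel

theorem IsEvenCartan.tw₁_odd [FiniteDimensional ℂ 𝔤₀] (hq : q ∈ S.rootPairs 𝔞 l)
    (hq' : q' ∈ S.rootPairs 𝔞 l) (h : 𝔞) (hl : l ∈ barRestrictedRoots₁ 𝔤₁ 𝔞)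
    (d : S.Sp) :
    S.tw₁ (Submodule.inclusion h𝔞.le h) q.1 (odd q'.2 * d) =
      -(S.b₁ q.1 q'.1 • (h𝔞.evenA l * d)) -
        odd q'.2 * S.tw₁ (Submodule.inclusion h𝔞.le h) q.1 d := by
  rw [SymmetricSuperpair.tw₁_odd, h𝔞.oddBracket_k_p hl hq hq', map_smul, smul_mul_assoc, neg_smul]
  rfl

theorem IsEvenCartan.tw₁_mem_rootWordSpan (h : 𝔞) (hq : q ∈ S.rootPairs 𝔞 l) {n : ℕ} {d : S.Sp}
    (hd : d ∈ h𝔞.rootWordSpan l h n) :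
    S.tw₁ (Submodule.inclusion h𝔞.le h) q.1 d ∈ h𝔞.rootWordSpan l h (n + 1) :=
  tw₁_mem_wordSpan (K := Prod.fst '' (S.rootPairs 𝔞 l : Set (S.k₁ × S.p₁))) ⟨q, hq, rfl⟩ hd

/-- The radial part kills `u_h(y) d` for `y ∈ 𝔨₁^l` and `d` in the span of words. -/
theorem IsEvenCartan.γ_tw₁_eq_zero (h : 𝔞) (hl : l ∈ barRestrictedRoots₁ 𝔤₁ 𝔞) (hlh : l h ≠ 0)
    (hz : Function.Bijective (S.Γ (Submodule.inclusion h𝔞.le h))) (hq : q ∈ S.rootPairs 𝔞 l)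
    {d : S.Sp} (hd : d ∈ ⨆ n, h𝔞.rootWordSpan l h n) :
    S.γ (Submodule.inclusion h𝔞.le h) (S.tw₁ (Submodule.inclusion h𝔞.le h) q.1 d) = 0 := by
  induction hd using Submodule.iSup_induction' with
  | zero => simp
  | add a b _ _ ha hb => rw [map_add, map_add, ha, hb, add_zero]
  | mem n a ha =>
    refine γ_eq_zero_of_mem_wordSpan hz ?_ ?_ ?_ ?_ (h𝔞.tw₁_mem_rootWordSpan h hq ha)
    · rintro _ ⟨r, hr, rfl⟩ _ ⟨s, hs, rfl⟩ _ ⟨P, rfl⟩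
      rw [AlgHom.toLinearMap_apply]
      induction P using Polynomial.induction_on with
      | C c =>
        rw [aeval_C, Algebra.algebraMap_eq_smul_one, map_smul, tw₀_one, h𝔞.adk₀p₀_lie₁₁ hl hr hs,
          map_zero, smul_zero]
      | add P Q hP hQ => rw [map_add, map_add, hP, hQ, add_zero]
      | monomial n c ih =>
        rw [pow_succ', mul_left_comm, map_mul, aeval_X, evenA, tw₀_even,
          h𝔞.adk₀p₀_lie₁₁ hl hr hs, map_zero, zero_mul, zero_add]
        exact (congrArg _ ih).trans (mul_zero _)
    · rintro _ ⟨r, hr, rfl⟩ _ ⟨s, hs, rfl⟩ _ ⟨t, ht, rfl⟩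
      exact ⟨_, h𝔞.lie_lie₁₁_mem_rootPairs hl hr hs ht, rfl⟩
    · rintro _ ⟨r, hr, rfl⟩
      -- Since `[h, z] = l(h) y`, dividing by `l(h) ≠ 0` exhibits `y` in the image of `ad h`.
      refine ⟨(l h)⁻¹ • r.2, ?_⟩
      rw [map_smul]
      refine Subtype.ext ((congrArg (fun x => (l h)⁻¹ • x) (h𝔞.lie_rootPairs hr h).2).trans ?_)
      rw [smul_smul, inv_mul_cancel₀ hlh, one_smul]
    · rintro _ ⟨P, rfl⟩
      exact ⟨_, h𝔞.evenPart_aeval P⟩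

theorem IsEvenCartan.tw₁_mem_iSup_rootWordSpan (h : 𝔞) (hq : q ∈ S.rootPairs 𝔞 l)
    {d : S.Sp} (hd : d ∈ ⨆ n, h𝔞.rootWordSpan l h n) :
    S.tw₁ (Submodule.inclusion h𝔞.le h) q.1 d ∈ ⨆ n, h𝔞.rootWordSpan l h n := by
  suffices hle : ⨆ n, h𝔞.rootWordSpan l h n ≤ (⨆ n, h𝔞.rootWordSpan l h n).comap
    (S.tw₁ (Submodule.inclusion h𝔞.le h) q.1) from hle hd
  exact iSup_le fun n d hd =>
    Submodule.mem_iSup_of_mem (n + 1) (h𝔞.tw₁_mem_rootWordSpan h hq hd)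

theorem IsEvenCartan.aeval_mem_iSup_rootWordSpan (h : 𝔞) (P : ℂ[X]) :
    aeval (h𝔞.evenA l) P ∈ ⨆ n, h𝔞.rootWordSpan l h n := by
  have hP : aeval (h𝔞.evenA l) P ∈ LinearMap.range (aeval (R := ℂ) (h𝔞.evenA l)).toLinearMap :=
    ⟨P, rfl⟩
  exact Submodule.mem_iSup_of_mem 0 (mem_wordSpan_zero hP)

/-- Solving the formula for `u_h(y) P(A_l)` for `z P(A_l)` leaves `z P'(A_l)`, so induction on the
degree applies. -/
theorem IsEvenCartan.odd_mul_aeval_mem (h : 𝔞) (hlh : l h ≠ 0)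
    (hq : q ∈ S.rootPairs 𝔞 l) (P : ℂ[X]) :
    odd q.2 * aeval (h𝔞.evenA l) P ∈ ⨆ n, h𝔞.rootWordSpan l h n := by
  have key : ∀ P : ℂ[X], odd q.2 * aeval (h𝔞.evenA l) (derivative P) ∈ ⨆ n, h𝔞.rootWordSpan l h n →
      odd q.2 * aeval (h𝔞.evenA l) P ∈ ⨆ n, h𝔞.rootWordSpan l h n := by
    intro P hP
    have h1 := h𝔞.tw₁_mem_iSup_rootWordSpan h hq (h𝔞.aeval_mem_iSup_rootWordSpan h P)
    rw [h𝔞.tw₁_aeval hq h] at h1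
    have h2 := Submodule.smul_mem _ (-(l h)⁻¹)
      (add_mem h1 (Submodule.smul_mem _ (l (S.A 𝔞 l)) hP))
    rwa [sub_add_cancel, smul_neg, neg_smul, neg_neg, smul_smul, inv_mul_cancel₀ hlh,
      one_smul] at h2
  induction hn : P.natDegree using Nat.strong_induction_on generalizing P with
  | _ n ih =>
    refine key P ?_
    by_cases h0 : P.natDegree = 0
    · rw [derivative_of_natDegree_zero h0, map_zero, mul_zero]; exact zero_mem _
    · exact ih _ (hn ▸ natDegree_derivative_lt h0) _ rfl

/-- Induction on word length: multiplication by `A_l` or by a vector `z` is moved past the leftmost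
operator. Moving `A_l` creates a factor `z` and moving `z` creates a factor `A_l`, so both claims
must be proved together. -/
theorem IsEvenCartan.mul_mem_iSup_rootWordSpan [FiniteDimensional ℂ 𝔤₀] (h : 𝔞) (hlh : l h ≠ 0)
    (hl : l ∈ barRestrictedRoots₁ 𝔤₁ 𝔞) {d : S.Sp} (hd : d ∈ ⨆ n, h𝔞.rootWordSpan l h n) :
    h𝔞.evenA l * d ∈ ⨆ n, h𝔞.rootWordSpan l h n ∧
      ∀ q ∈ S.rootPairs 𝔞 l, odd q.2 * d ∈ ⨆ n, h𝔞.rootWordSpan l h n := by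
  let G : Submodule ℂ S.Sp :=
    (⨆ n, h𝔞.rootWordSpan l h n).comap (LinearMap.mulLeft ℂ (h𝔞.evenA l)) ⊓
      ⨅ q ∈ S.rootPairs 𝔞 l,
        (⨆ n, h𝔞.rootWordSpan l h n).comap (LinearMap.mulLeft ℂ (odd q.2))
  have hG : ∀ d, d ∈ G ↔ h𝔞.evenA l * d ∈ ⨆ n, h𝔞.rootWordSpan l h n ∧
      ∀ q ∈ S.rootPairs 𝔞 l, odd q.2 * d ∈ ⨆ n, h𝔞.rootWordSpan l h n := fun d => by
    simp [G, Submodule.mem_iInf]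
  rw [← hG]
  suffices hle : ∀ n, h𝔞.rootWordSpan l h n ≤ G from iSup_le hle hd
  intro n
  induction n with
  | zero =>
    refine wordSpan_zero_le.trans ?_
    rintro _ ⟨P, rfl⟩
    refine (hG _).2 ⟨?_, fun q hq => h𝔞.odd_mul_aeval_mem h hlh hq P⟩
    have := h𝔞.aeval_mem_iSup_rootWordSpan (l := l) h (X * P)
    rwa [map_mul, aeval_X] at this
  | succ n ih =>
    refine wordSpan_succ_le ?_
    rintro _ ⟨q, hq, rfl⟩ d hd
    obtain ⟨h1, h2⟩ := (hG d).1 (ih hd)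
    refine (hG _).2 ⟨?_, fun q' hq' => ?_⟩
    · rw [eq_sub_of_add_eq' (h𝔞.tw₁_evenA hq h d).symm]
      exact sub_mem (h𝔞.tw₁_mem_iSup_rootWordSpan h hq h1) (Submodule.smul_mem _ _ (h2 q hq))
    · rw [← sub_eq_iff_eq_add'.2 (sub_eq_iff_eq_add.1 (h𝔞.tw₁_odd hq hq' h hl d).symm)]
      exact sub_mem (neg_mem (Submodule.smul_mem _ _ h1))
        (h𝔞.tw₁_mem_iSup_rootWordSpan h hq (h2 q' hq'))

end

/-! ### The recursion for radial parts and its solution. -/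

section bases

variable {n : ℕ} (B : S.SymplecticBases 𝔞 l n)

/-- The product of the even elements `zᵢ z'ᵢ` for `i` in a list. -/
def SymplecticBases.pairProd (J : List (Fin n)) : S.Sp :=
  (J.map fun i => odd (B.z i) * odd (B.z' i)).prod

theorem SymplecticBases.pairProd_cons (i : Fin n) (J : List (Fin n)) :
    B.pairProd (i :: J) = odd (B.z i) * odd (B.z' i) * B.pairProd J := by
  rw [pairProd, List.map_cons, List.prod_cons, pairProd]

theorem SymplecticBases.pairProd_mul_odd (J : List (Fin n)) (w : S.p₁) :
    B.pairProd J * odd w = odd w * B.pairProd J := by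
  induction J with
  | nil => simp [pairProd]
  | cons i J ih =>
    rw [pairProd_cons, mul_assoc, ih, ← mul_assoc, ← mul_assoc, mul_assoc (odd _), odd_mul_odd _ w,
      mul_neg, ← mul_assoc, odd_mul_odd _ w]
    simp only [neg_mul, neg_neg, mul_assoc]

theorem odd_mul_prod_map_odd {ι : Type*} (f : ι → S.p₁) (J : List ι) (w : S.p₁) :
    (J.map fun i => (odd (f i) : S.Sp)).prod * odd w =
      (-1 : ℂ) ^ J.length • (odd w * (J.map fun i => odd (f i)).prod) := by
  induction J with
  | nil => simp
  | cons i J ih =>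
    rw [List.map_cons, List.prod_cons, mul_assoc, ih, List.length_cons, pow_succ, mul_smul_comm,
      ← mul_assoc, odd_mul_odd _ w, neg_mul, mul_assoc, smul_neg, mul_neg_one, neg_smul]

/-- Bringing `z'ᵢ` next to `zᵢ` passes all remaining `zⱼ`; the numbers of these sign changes add up
to a triangular number. -/
theorem SymplecticBases.prod_odd_mul_prod_odd (J : List (Fin n)) :
    (J.map fun i => (odd (B.z i) : S.Sp)).prod * (J.map fun i => odd (B.z' i)).prod =
      (-1 : ℂ) ^ (J.length * (J.length - 1) / 2) • B.pairProd J := by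
  induction J with
  | nil => simp [pairProd]
  | cons i J ih =>
    rw [List.map_cons, List.prod_cons, List.map_cons, List.prod_cons, pairProd_cons,
      List.length_cons, Nat.triangle_succ, mul_assoc (odd _), ← mul_assoc _ (odd (B.z' i)),
      odd_mul_prod_map_odd, smul_mul_assoc, mul_assoc (odd (B.z' i)), ih, mul_smul_comm,
      mul_smul_comm, mul_smul_comm, smul_smul, ← mul_assoc, ← pow_add, add_comm]

theorem SymplecticBases.yz_mem (i : Fin n) : (B.y i, B.z i) ∈ S.rootPairs 𝔞 l := B.x_mem i

theorem SymplecticBases.yz'_mem (i : Fin n) : (B.y' i, B.z' i) ∈ S.rootPairs 𝔞 l := B.x'_mem i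

variable [FiniteDimensional ℂ 𝔤₀]

/-- For `j ≠ i`, `yᵢ` is `b`-orthogonal to `yⱼ` and `y'ⱼ`, so no `A_l` appears and the two signs
from `zⱼ` and `z'ⱼ` cancel. -/
theorem SymplecticBases.tw₁_pairProd_mul (h𝔞 : S.IsEvenCartan 𝔞) (h : 𝔞)
    (hl : l ∈ barRestrictedRoots₁ 𝔤₁ 𝔞) {i : Fin n} {J : List (Fin n)} (hi : i ∉ J) (d : S.Sp) :
    S.tw₁ (Submodule.inclusion h𝔞.le h) (B.y i) (B.pairProd J * d) =
      B.pairProd J * S.tw₁ (Submodule.inclusion h𝔞.le h) (B.y i) d := by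
  induction J with
  | nil => simp [pairProd]
  | cons j J ih =>
    rw [List.mem_cons, not_or] at hi
    have h1 := fun d => h𝔞.tw₁_odd (B.yz_mem i) (B.yz_mem j) h hl d
    have h2 := fun d => h𝔞.tw₁_odd (B.yz_mem i) (B.yz'_mem j) h hl d
    simp only [B.b_y_y, B.b_y_y', if_neg hi.1, zero_smul, neg_zero, zero_sub] at h1 h2
    rw [pairProd_cons, mul_assoc, mul_assoc, h1, h2, ih hi.2, mul_neg, neg_neg, mul_assoc, mul_assoc]

theorem SymplecticBases.pairProd_mul_aeval_mem (h𝔞 : S.IsEvenCartan 𝔞) (h : 𝔞) (hlh : l h ≠ 0)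
    (hl : l ∈ barRestrictedRoots₁ 𝔤₁ 𝔞) (J : List (Fin n)) (P : ℂ[X]) :
    B.pairProd J * aeval (h𝔞.evenA l) P ∈ ⨆ n, h𝔞.rootWordSpan l h n := by
  induction J with
  | nil => simpa [pairProd] using h𝔞.aeval_mem_iSup_rootWordSpan h P
  | cons j J ih =>
    rw [pairProd_cons, mul_assoc, mul_assoc]
    exact (h𝔞.mul_mem_iSup_rootWordSpan h hlh hl
      ((h𝔞.mul_mem_iSup_rootWordSpan h hlh hl ih).2 (B.y' j, B.z' j) (B.yz'_mem j))).2
      (B.y j, B.z j) (B.yz_mem j)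

/-- The recursion for radial parts. -/
theorem SymplecticBases.γ_pairProd_cons (h𝔞 : S.IsEvenCartan 𝔞) (h : 𝔞) (hlh : l h ≠ 0)
    (hl : l ∈ barRestrictedRoots₁ 𝔤₁ 𝔞)
    (hz : Function.Bijective (S.Γ (Submodule.inclusion h𝔞.le h)))
    {i : Fin n} {J : List (Fin n)} (hi : i ∉ J) (P : ℂ[X]) :
    S.γ (Submodule.inclusion h𝔞.le h) (B.pairProd (i :: J) *
      aeval (h𝔞.evenA l) (P + C (l (S.A 𝔞 l) / l h) * derivative P)) =
    -(l h)⁻¹ • S.γ (Submodule.inclusion h𝔞.le h) (B.pairProd J * aeval (h𝔞.evenA l) (X * P)) := by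
  -- The element to differentiate is `z'ᵢ Z_J P(A_l)`: `yᵢ` contracts with `z'ᵢ` to give `-A_l`, or
  -- reaches `P(A_l)` and creates the missing `zᵢ`.
  have h0 := h𝔞.γ_tw₁_eq_zero h hl hlh hz (B.yz_mem i)
    ((h𝔞.mul_mem_iSup_rootWordSpan h hlh hl
      (B.pairProd_mul_aeval_mem h𝔞 h hlh hl J P)).2 (B.y' i, B.z' i) (B.yz'_mem i))
  have h1 : aeval (h𝔞.evenA l) (P + C (l (S.A 𝔞 l) / l h) * derivative P) =
      aeval (h𝔞.evenA l) P + (l (S.A 𝔞 l) / l h) • aeval (h𝔞.evenA l) (derivative P) := by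
    rw [← smul_eq_C_mul, map_add, map_smul]
  have h2 : S.tw₁ (Submodule.inclusion h𝔞.le h) (B.y i) (aeval (h𝔞.evenA l) P) =
      -(l h • (odd (B.z i) *
        aeval (h𝔞.evenA l) (P + C (l (S.A 𝔞 l) / l h) * derivative P))) := by
    rw [h𝔞.tw₁_aeval (B.yz_mem i), h1, mul_add, smul_add, mul_smul_comm, smul_smul,
      mul_div_cancel₀ _ hlh]
    abel
  have h3 : h𝔞.evenA l * (B.pairProd J * aeval (h𝔞.evenA l) P) =
      B.pairProd J * aeval (h𝔞.evenA l) (X * P) := by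
    rw [← mul_assoc, IsEvenCartan.evenA, even_mul_comm, mul_assoc, map_mul, aeval_X]
  set Q := P + C (l (S.A 𝔞 l) / l h) * derivative P
  have h4 : odd (B.z' i) * (B.pairProd J * -(l h • (odd (B.z i) * aeval (h𝔞.evenA l) Q))) =
      l h • (B.pairProd (i :: J) * aeval (h𝔞.evenA l) Q) := by
    rw [mul_neg, mul_neg, mul_smul_comm, mul_smul_comm, ← mul_assoc (B.pairProd J),
      pairProd_mul_odd, ← mul_assoc, ← mul_assoc, odd_mul_odd (B.z' i), neg_mul, neg_mul, smul_neg,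
      neg_neg, pairProd_cons]
  rw [h𝔞.tw₁_odd (B.yz_mem i) (B.yz'_mem i) h hl, B.tw₁_pairProd_mul h𝔞 h hl hi, h2, h3, h4,
    B.b_y_y', if_pos rfl, one_smul, map_sub, map_neg, map_smul, sub_eq_zero] at h0
  rw [neg_smul, ← smul_neg, h0, smul_smul, inv_mul_cancel₀ hlh, one_smul]

/-- Each pair is removed by the recursion with `P` the Bessel polynomial of index `k + 1`, which
raises the index by one. -/
theorem SymplecticBases.γ_pairProd_mul_bessel (h𝔞 : S.IsEvenCartan 𝔞) (h : 𝔞) (hlh : l h ≠ 0)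
    (hl : l ∈ barRestrictedRoots₁ 𝔤₁ 𝔞)
    (hz : Function.Bijective (S.Γ (Submodule.inclusion h𝔞.le h)))
    {J : List (Fin n)} (hJ : J.Nodup) (k : ℕ) :
    S.γ (Submodule.inclusion h𝔞.le h) (B.pairProd J *
      aeval (h𝔞.evenA l) (X * bessel (l (S.A 𝔞 l) / l h) k)) =
    (-(l h)⁻¹) ^ J.length • aeval (SymmetricAlgebra.ι ℂ S.p₀ (Submodule.inclusion h𝔞.le (S.A 𝔞 l)))
      (X * bessel (l (S.A 𝔞 l) / l h) (k + J.length)) := by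
  induction J generalizing k with
  | nil =>
    rw [pairProd, List.map_nil, List.prod_nil, one_mul, ← h𝔞.evenPart_aeval, S.γ_evenPart hz]
    simp
  | cons i J ih =>
    rw [List.nodup_cons] at hJ
    rw [← bessel_succ_add_derivative, B.γ_pairProd_cons h𝔞 h hlh hl hz hJ.1, ih hJ.2, smul_smul,
      List.length_cons, ← pow_succ', add_right_comm, add_assoc]

/-- The first removal uses `P = 1` and creates the factor `X`, so the final Bessel index is one less
than the number of pairs. -/
theorem SymplecticBases.γ_pairProd (h𝔞 : S.IsEvenCartan 𝔞) (h : 𝔞) (hlh : l h ≠ 0)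
    (hl : l ∈ barRestrictedRoots₁ 𝔤₁ 𝔞)
    (hz : Function.Bijective (S.Γ (Submodule.inclusion h𝔞.le h)))
    {J : List (Fin n)} (hJ : J.Nodup) {k : ℕ} (hk : J.length = k + 1) :
    S.γ (Submodule.inclusion h𝔞.le h) (B.pairProd J) =
    (-(l h)⁻¹) ^ (k + 1) •
      aeval (SymmetricAlgebra.ι ℂ S.p₀ (Submodule.inclusion h𝔞.le (S.A 𝔞 l)))
        (X * bessel (l (S.A 𝔞 l) / l h) k) := by
  cases J with
  | nil => simp at hk
  | cons i J =>
    rw [List.nodup_cons] at hJ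
    have h1 := B.γ_pairProd_cons h𝔞 h hlh hl hz hJ.1 (bessel (l (S.A 𝔞 l) / l h) 0)
    rw [B.γ_pairProd_mul_bessel h𝔞 h hlh hl hz hJ.2, bessel_zero, derivative_one, mul_zero, add_zero,
      map_one, mul_one, smul_smul, ← pow_succ', zero_add] at h1
    rw [h1, Nat.succ_injective hk]

theorem SymplecticBases.γ_monomial (h𝔞 : S.IsEvenCartan 𝔞) (h : 𝔞) (hlh : l h ≠ 0)
    (hl : l ∈ barRestrictedRoots₁ 𝔤₁ 𝔞)
    (hz : Function.Bijective (S.Γ (Submodule.inclusion h𝔞.le h)))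
    {k : ℕ} {I : Fin (k + 1) → Fin n} (hI : Function.Injective I) :
    S.γ (Submodule.inclusion h𝔞.le h) (B.monomial I) =
      (-1 : ℂ) ^ ((k + 1) * (k + 1 + 1) / 2) •
        ∑ j ∈ Finset.range (k + 1),
          (((k + j).factorial : ℂ) / (2 ^ j * (k - j).factorial * j.factorial) *
            ((-l (S.A 𝔞 l)) ^ j / l h ^ (k + 1 + j))) •
          SymmetricAlgebra.ι ℂ S.p₀ (Submodule.inclusion h𝔞.le (S.A 𝔞 l)) ^ (k + 1 - j) := by
  have h1 := B.prod_odd_mul_prod_odd (List.ofFn I)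
  rw [List.map_ofFn, List.map_ofFn, List.length_ofFn] at h1
  -- The total sign splits into the sorting sign and the `(-1)^(k + 1)` from the powers of `-(l
  -- h)⁻¹`.
  have h2 : (k + 1) * (k + 1 + 1) / 2 = (k + 1) * (k + 1 - 1) / 2 + (k + 1) := by
    rw [← Nat.triangle_succ (k + 1), Nat.add_sub_cancel, mul_comm]
  rw [SymplecticBases.monomial]
  refine (congrArg _ h1).trans ?_
  rw [map_smul, B.γ_pairProd h𝔞 h hlh hl hz (List.nodup_ofFn.2 hI) (k := k) (List.length_ofFn ..),
    h2, pow_add (-1 : ℂ), mul_smul ((-1 : ℂ) ^ _)]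
  congr 1
  rw [bessel, Finset.mul_sum, map_sum, Finset.smul_sum, Finset.smul_sum]
  refine Finset.sum_congr rfl fun j hj => ?_
  have hj' : k + 1 - j = k - j + 1 := by have := Finset.mem_range.1 hj; omega
  rw [mul_left_comm, ← pow_succ', ← hj', ← smul_eq_C_mul, map_smul, map_pow, aeval_X, smul_smul,
    smul_smul]
  congr 1
  rw [← neg_div, div_pow, neg_pow (l h)⁻¹, inv_pow, pow_add (l h) (k + 1)]
  field_simp

end bases

end SymmetricSuperpair

end

theorem mainTheorem5 {𝔤₀ 𝔤₁ : Type*} [LieRing 𝔤₀] [LieAlgebra ℂ 𝔤₀] [AddCommGroup 𝔤₁]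
    [Module ℂ 𝔤₁] [LieRingModule 𝔤₀ 𝔤₁] [LieModule ℂ 𝔤₀ 𝔤₁] [FiniteDimensional ℂ 𝔤₀]
    [FiniteDimensional ℂ 𝔤₁] [LieSuperalgebra 𝔤₀ 𝔤₁]
    (S : SymmetricSuperpair 𝔤₀ 𝔤₁) (hS : S.IsReductive)
    (𝔞 : Submodule ℂ 𝔤₀) (h𝔞 : S.IsEvenCartan 𝔞)
    (P : Set (Module.Dual ℂ 𝔞)) (hP : SymmetricSuperpair.IsPositiveSystem 𝔤₁ 𝔞 P)
    (l : Module.Dual ℂ 𝔞) (hl : l ∈ SymmetricSuperpair.barRestrictedRoots₁ 𝔤₁ 𝔞) (hlP : l ∈ P)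
    (n : ℕ) (B : S.SymplecticBases 𝔞 l n)
    (h : 𝔞) (hh : S.IsOddlyRegular (Submodule.inclusion h𝔞.le h))
    (k : ℕ) (hk : 1 ≤ k) (I : Fin k → Fin n) (hI : StrictMono I) :
    (∀ h' : 𝔞, S.b₀ (S.A 𝔞 l) h' = l h') ∧
    l h ≠ 0 ∧
    Function.Bijective (S.Γ (Submodule.inclusion h𝔞.le h)) ∧
    S.γ (Submodule.inclusion h𝔞.le h) (B.monomial I) =
      (-1 : ℂ) ^ (k * (k + 1) / 2) •
        ∑ j ∈ Finset.range k,
          (((k - 1 + j).factorial : ℂ) /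
              (2 ^ j * (k - 1 - j).factorial * j.factorial) *
            ((-l (S.A 𝔞 l)) ^ j / l h ^ (k + j))) •
          SymmetricAlgebra.ι ℂ S.p₀ (Submodule.inclusion h𝔞.le (S.A 𝔞 l)) ^ (k - j) := by
  obtain ⟨k, rfl⟩ := Nat.exists_eq_add_of_le' hk
  -- As `|I| ≥ 1`, there is a basis vector `y`, nonzero because `b(y, y') = 1`; this provides the
  -- root vector that forces `l h ≠ 0`.
  have hy : B.y (I 0) ≠ 0 := fun h0 => by
    have := B.b_y_y' (I 0) (I 0)
    rw [h0, if_pos rfl, ZeroMemClass.coe_zero, map_zero, LinearMap.zero_apply] at this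
    exact zero_ne_one this
  have hlh : l h ≠ 0 := h𝔞.apply_ne_zero hh (B.yz_mem (I 0)) hy hl.1.1
  have hz := S.Γ_bijective _ (h𝔞.adp₀k₁_adp₀p₁_injective hS h hh)
  exact ⟨h𝔞.b₀_A l, hlh, hz, B.γ_monomial h𝔞 h hlh hl hz hI.injective⟩
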